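/- For a permutation $\pi$ of $[\ell]$, a sequence $s_1,\dots,s_k$ over a linearly ordered set contains $\pi$ if there are indices $i_1<\dots<i_\ell$ such that $s_{i_a}<s_{i_b}$ if and only if $\pi_a<\pi_b$ for all $a,b\in[\ell]$; otherwise it avoids $\pi$ (repeated values are allowed). A binary matrix contains $\pi$ if the permutation matrix of $\pi$ can be obtained from it by deleting rows and columns and changing 1-entries to 0; let $\mathrm{ex}_\pi(n)$ be the maximum number of 1-entries in an $n\times n$ binary matrix not containing $\pi$. The limit $c_\pi=\lim_{n\to\infty}\mathrm{ex}_\pi(n)/n$ (the Füredi–Hajnal limit) exists for every $\pi$. Theorem. There is a single deterministic comparison-based algorithm (a fixed random access machine program with unit-cost steps, which may only copy the sequence elements and compare them with each other) with the following property. Given $k\ge 1$, $m\ge 0$ and sequences $S_1,\dots,S_m$ over a linearly ordered set, each of length $k$, put $n=mk$, so that there are $n/k$ sequences. For every permutation $\pi$ that is avoided by all of $S_1,\dots,S_m$, the algorithm sorts each of $S_1,\dots,S_m$ in time $$O\big((\log_2 c_\pi+1)\cdot n\big)+2^{2^{O(k\log k)}},$$ where the constants hidden in the $O$-notation are absolute.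 The algorithm does not receive $\pi$ or $c_\pi$ as input. (If $c_\pi=0$, then $\pi$ has length at most $1$; if $\pi$ is moreover avoided by all $S_i$, then $n=0$ and the first term is read as $0$.) -/

import Mathlib

open Filter Topology Asymptotics

namespace PatternSort

/-! ### Pattern avoidance and the Füredi–Hajnal limit -/

/-- The sequence `s` contains the permutation `π`: some subsequence of `s` is order-isomorphic
to `π`. -/
def SeqContains {α : Type*} [LinearOrder α] {k l : ℕ} (s : Fin k → α)
    (π : Equiv.Perm (Fin l)) : Prop :=
  ∃ p : Fin l ↪o Fin k, ∀ a b : Fin l, s (p a) < s (p b) ↔ π a < π b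

/-- The sequence `s` avoids the permutation `π`. -/
def SeqAvoids {α : Type*} [LinearOrder α] {k l : ℕ} (s : Fin k → α)
    (π : Equiv.Perm (Fin l)) : Prop :=
  ¬ SeqContains s π

/-- The binary matrix `M` contains the binary matrix `P`: `P` arises from `M` by deleting rows and
columns and changing some 1-entries to zero. The first index is the column, the second the row. -/
def MatContains {m n p q : ℕ} (M : Fin m → Fin n → Bool) (P : Fin p → Fin q → Bool) : Prop :=
  ∃ (c : Fin p ↪o Fin m) (r : Fin q ↪o Fin n),
    ∀ i j, P i j = true → M (c i) (r j) = true

/-- The permutation matrix of `π`. -/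
def permMat {l : ℕ} (π : Equiv.Perm (Fin l)) : Fin l → Fin l → Bool :=
  fun i j => decide (π i = j)

/-- The number of 1-entries of a binary matrix. -/
def ones {m n : ℕ} (M : Fin m → Fin n → Bool) : ℕ :=
  (Finset.univ.filter fun e : Fin m × Fin n => M e.1 e.2 = true).card

open Classical in
/-- The maximum number of 1-entries in an `n × n` binary matrix that avoids `π`. -/
noncomputable def ex {l : ℕ} (π : Equiv.Perm (Fin l)) (n : ℕ) : ℕ :=
  (Finset.univ.filter fun M : Fin n → Fin n → Bool => ¬ MatContains M (permMat π)).sup ones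

/-- The Füredi–Hajnal limit `c_π = lim ex_π(n) / n`. -/
noncomputable def furediHajnalLimit {l : ℕ} (π : Equiv.Perm (Fin l)) : ℝ :=
  limUnder atTop fun n : ℕ => (ex π n : ℝ) / n

/-! ### A comparison-based random access machine

The machine has integer registers, integer arrays and arrays of elements of a linear order `α`,
all named by numerals that occur in the program, so a program uses finitely many of them. Array
cells are addressed by the contents of registers. Elements can only be copied and compared with
each other. The only arithmetic operations are zero, successor and predecessor, so that after `t`
steps no integer exceeds the largest integer of the input by more than `t`. -/

/-- Machine states: registers, integer arrays, and element arrays (a cell may be empty). -/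
structure State (α : Type*) where
  reg : ℕ → ℕ
  mem : ℕ → ℕ → ℕ
  elt : ℕ → ℕ → Option α

/-- Tests: `natLt x y` and `natEq x y` compare registers `x` and `y`; `elemLe a x b y` compares
the element in array `a` at the address in register `x` with the element in array `b` at the
address in register `y`. -/
inductive Test where
  | natLt (x y : ℕ)
  | natEq (x y : ℕ)
  | elemLe (a x b y : ℕ)

/-- Programs. `x`, `y` are registers, `a`, `b` are arrays:
`zero x` is `x := 0`, `copy x y` is `x := y`, `succ x` is `x := x + 1`, `pred x` is `x := x - 1`
(truncated at `0`), `load x a y` is `x := a[y]` and `store a y x` is `a[y] := x` for an integer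
array `a`, and `move a x b y` is `a[x] := b[y]` for element arrays `a` and `b`. -/
inductive Prog where
  | skip
  | zero (x : ℕ)
  | copy (x y : ℕ)
  | succ (x : ℕ)
  | pred (x : ℕ)
  | load (x a y : ℕ)
  | store (a y x : ℕ)
  | move (a x b y : ℕ)
  | seq (P Q : Prog)
  | ite (b : Test) (P Q : Prog)
  | loop (b : Test) (P : Prog)

namespace State

variable {α : Type*}

/-- Write `v` into register `x`. -/
def setReg (s : State α) (x v : ℕ) : State α :=
  { s with reg := Function.update s.reg x v }

/-- Write `v` into cell `i` of the integer array `a`. -/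
def setMem (s : State α) (a i v : ℕ) : State α :=
  { s with mem := Function.update s.mem a (Function.update (s.mem a) i v) }

/-- Write `v` into cell `i` of the element array `a`. -/
def setElt (s : State α) (a i : ℕ) (v : Option α) : State α :=
  { s with elt := Function.update s.elt a (Function.update (s.elt a) i v) }

end State

/-- The test succeeds in the given state (a comparison with an empty cell fails). -/
def Test.Holds {α : Type*} [LinearOrder α] (s : State α) : Test → Prop
  | .natLt x y => s.reg x < s.reg y
  | .natEq x y => s.reg x = s.reg y
  | .elemLe a x b y =>
      ∃ u v : α, s.elt a (s.reg x) = some u ∧ s.elt b (s.reg y) = some v ∧ u ≤ v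

/-- `Exec P s t s'`: started in state `s`, the program `P` halts in state `s'` after exactly `t`
steps. Every elementary instruction and every evaluation of a test takes one step. -/
inductive Exec {α : Type*} [LinearOrder α] : Prog → State α → ℕ → State α → Prop where
  | skip (s : State α) : Exec .skip s 1 s
  | zero (s : State α) (x : ℕ) : Exec (.zero x) s 1 (s.setReg x 0)
  | copy (s : State α) (x y : ℕ) : Exec (.copy x y) s 1 (s.setReg x (s.reg y))
  | succ (s : State α) (x : ℕ) : Exec (.succ x) s 1 (s.setReg x (s.reg x + 1))
  | pred (s : State α) (x : ℕ) : Exec (.pred x) s 1 (s.setReg x (s.reg x - 1))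
  | load (s : State α) (x a y : ℕ) :
      Exec (.load x a y) s 1 (s.setReg x (s.mem a (s.reg y)))
  | store (s : State α) (a y x : ℕ) :
      Exec (.store a y x) s 1 (s.setMem a (s.reg y) (s.reg x))
  | move (s : State α) (a x b y : ℕ) :
      Exec (.move a x b y) s 1 (s.setElt a (s.reg x) (s.elt b (s.reg y)))
  | seq {P Q : Prog} {s s' s'' : State α} {t t' : ℕ} :
      Exec P s t s' → Exec Q s' t' s'' → Exec (.seq P Q) s (t + t') s''
  | ite_true {b : Test} {P Q : Prog} {s s' : State α} {t : ℕ} :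
      b.Holds s → Exec P s t s' → Exec (.ite b P Q) s (t + 1) s'
  | ite_false {b : Test} {P Q : Prog} {s s' : State α} {t : ℕ} :
      ¬ b.Holds s → Exec Q s t s' → Exec (.ite b P Q) s (t + 1) s'
  | loop_done {b : Test} {P : Prog} {s : State α} :
      ¬ b.Holds s → Exec (.loop b P) s 1 s
  | loop_step {b : Test} {P : Prog} {s s' s'' : State α} {t t' : ℕ} :
      b.Holds s → Exec P s t s' → Exec (.loop b P) s' t' s'' →
        Exec (.loop b P) s (t + t' + 1) s''

/-- The initial state for `m` sequences of length `k`: register `0` holds `k`, register `1` holds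
`m`, the cells `0, …, m * k - 1` of element array `0` hold the sequences one after the other, and
everything else is zero or empty. -/
def initState {α : Type*} {m k : ℕ} (S : Fin m → Fin k → α) : State α where
  reg x := if x = 0 then k else if x = 1 then m else 0
  mem _ _ := 0
  elt a i :=
    if h : a = 0 ∧ i < m * k then
      some (S (Fin.divNat ⟨i, h.2⟩) (Fin.modNat ⟨i, h.2⟩))
    else none

/-- In the state `s`, each of the sequences in element array `0` has been replaced by its sorted
rearrangement. -/
def IsSortedOutput {α : Type*} [LinearOrder α] {m k : ℕ} (S : Fin m → Fin k → α)
    (s : State α) : Prop :=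
  ∀ i : Fin m, ∃ σ : Equiv.Perm (Fin k), Monotone (S i ∘ σ) ∧
    ∀ j : Fin k, s.elt 0 (i * k + j) = some (S i (σ j))

/-- On input `S`, the program `P` halts within time `T` and sorts all sequences of `S`. -/
def SortsWithin {α : Type*} [LinearOrder α] {m k : ℕ} (P : Prog) (S : Fin m → Fin k → α)
    (T : ℝ) : Prop :=
  ∃ (t : ℕ) (s : State α), Exec P (initState S) t s ∧ (t : ℝ) ≤ T ∧ IsSortedOutput S s

end PatternSort

namespace PatternSort

/-! ### Permutation patterns in binary matrices -/

/-! The algorithm does not know `π`, but some decision tree of depth `D = O(k (log c_π + 1))` sorts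
every sequence of length `k` that avoids `π`. It runs through all tables that can encode decision
trees, in order of depth. The current table is tried on the current sequence and its answer is
verified in time `O(k)`: a success keeps the table, a failure moves on to the next one. The table of
a good tree never fails, so the search never passes it. Hence every attempt uses depth at most `D`,
and the number of failures is bounded in terms of `k` and `D`. As `D = O(k log k)` for every `π`,
all failures together cost `2^(2^(O(k log k)))`, while each success costs `O(D + k)`
(`runs_attemptProg`, `exists_exec_sortProg`, `overhead_le`).

The good tree comes from counting. Comparisons do not distinguish a sequence from its word of ranks,
so only the finite set `V` of words over `Fin k` avoiding `π` matters. A tree of depth `2 (k + log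
|V|)` sorts `V` (`sortable_finset`): positions are inserted one at a time, and at most two
comparisons around a median insertion place either determine the place or halve the set of remaining
words.

The bound `log |V| = O(k (log c_π + 1))` is `card_avoidingWords_le`. Contracting the matrix of a
word to blocks of side about `c_π` leaves a matrix avoiding `π` with `O(k / c_π)` rows. There are
`2^(O(k))` such matrices, by repeated `2 × 2` contraction (`card_avoidingMatrices_mul_two_le`), and
each arises from `c_π^(2k) 2^(O(k))` words (`card_words_contract_le`).

The limit exists by Fekete's lemma, since `ex π` is superadditive (`ex_add_le`) and linearly bounded
by the Marcus–Tardos argument (`ex_mul_le`). Fekete's lemma also gives `ex π n ≤ c_π n` for every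
`n`, which the counting uses. -/

theorem matContains_permMat_iff {m n l : ℕ} {M : Fin m → Fin n → Bool} {π : Equiv.Perm (Fin l)} :
    MatContains M (permMat π) ↔ ∃ (c : Fin l → Fin m) (r : Fin l → Fin n),
      StrictMono c ∧ StrictMono r ∧ ∀ i, M (c i) (r (π i)) = true := by
  constructor
  · rintro ⟨c, r, h⟩
    exact ⟨c, r, c.strictMono, r.strictMono, fun i => h i _ (by simp [permMat])⟩
  · rintro ⟨c, r, hc, hr, h⟩
    refine ⟨OrderEmbedding.ofStrictMono c hc, OrderEmbedding.ofStrictMono r hr, fun i j hij => ?_⟩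
    have : π i = j := by simpa [permMat] using hij
    subst this
    exact h i

open Classical in
/-- The contraction of a matrix along maps of its columns and rows to blocks. -/
noncomputable def contract {m n p q : ℕ} (f : Fin m → Fin p) (g : Fin n → Fin q)
    (M : Fin m → Fin n → Bool) : Fin p → Fin q → Bool :=
  fun I J => decide (∃ i j, f i = I ∧ g j = J ∧ M i j = true)

theorem contract_apply {m n p q : ℕ} {f : Fin m → Fin p} {g : Fin n → Fin q}
    {M : Fin m → Fin n → Bool} {I : Fin p} {J : Fin q} :
    contract f g M I J = true ↔ ∃ i j, f i = I ∧ g j = J ∧ M i j = true := by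
  simp [contract]

/-- One 1-entry is chosen in each block of the copy. A permutation matrix has a single 1 in each row
and column, so the chosen entries lie in distinct block rows and block columns, and their order is
that of the blocks. -/
theorem MatContains.of_contract {m n p q l : ℕ} {f : Fin m → Fin p} {g : Fin n → Fin q}
    (hf : Monotone f) (hg : Monotone g) {M : Fin m → Fin n → Bool} {π : Equiv.Perm (Fin l)}
    (h : MatContains (contract f g M) (permMat π)) : MatContains M (permMat π) := by
  obtain ⟨c, r, hc, hr, h⟩ := matContains_permMat_iff.1 h
  simp only [contract_apply] at h
  choose i j hi hj hij using h
  refine matContains_permMat_iff.2 ⟨i, fun b => j (π.symm b), fun a b hab => ?_, fun a b hab => ?_,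
    fun a => by simpa using hij a⟩
  · exact hf.reflect_lt (by rw [hi, hi]; exact hc hab)
  · refine hg.reflect_lt ?_
    rw [hj, hj]
    exact hr (by simpa using hab)

theorem ones_le_ex {l n : ℕ} {π : Equiv.Perm (Fin l)} {M : Fin n → Fin n → Bool}
    (h : ¬ MatContains M (permMat π)) : ones M ≤ ex π n := by
  classical
  exact Finset.le_sup (f := ones) (by simpa using h)

theorem ex_le {l n B : ℕ} {π : Equiv.Perm (Fin l)}
    (h : ∀ M : Fin n → Fin n → Bool, ¬ MatContains M (permMat π) → ones M ≤ B) : ex π n ≤ B := by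
  classical
  exact Finset.sup_le fun M hM => h M (by simpa using hM)

/-- The supremum is attained because the zero matrix avoids every nonempty pattern. The empty
pattern is contained in every matrix, whence `1 ≤ l`. -/
theorem exists_ones_eq_ex {l : ℕ} (hl : 1 ≤ l) (π : Equiv.Perm (Fin l)) (n : ℕ) :
    ∃ M : Fin n → Fin n → Bool, ¬ MatContains M (permMat π) ∧ ones M = ex π n := by
  classical
  obtain ⟨M, hM, h⟩ := Finset.exists_mem_eq_sup
    (Finset.univ.filter fun M : Fin n → Fin n → Bool => ¬ MatContains M (permMat π))
    ⟨fun _ _ => false, by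
      simp only [Finset.mem_filter, Finset.mem_univ, true_and, matContains_permMat_iff]
      rintro ⟨c, r, -, -, h⟩
      simpa using h ⟨0, hl⟩⟩ ones
  refine ⟨M, by simpa using hM, h.symm.trans ?_⟩
  unfold ex
  congr!

theorem ones_le_sq {m n : ℕ} (M : Fin m → Fin n → Bool) : ones M ≤ m * n := by
  refine (Finset.card_le_univ _).trans ?_
  simp

theorem ex_zero_of_length_le_one {l : ℕ} (hl : l ≤ 1) (π : Equiv.Perm (Fin l)) (n : ℕ) :
    ex π n = 0 := by
  refine Nat.le_zero.1 (ex_le fun M hM => ?_)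
  by_contra h
  have hpos : 0 < ones M := Nat.pos_of_ne_zero fun h' => h h'.le
  obtain ⟨e, he⟩ := Finset.card_pos.1 hpos
  have he : M e.1 e.2 = true := by simpa using he
  have : Subsingleton (Fin l) := Fin.subsingleton_iff_le_one.2 hl
  exact hM (matContains_permMat_iff.2 ⟨fun _ => e.1, fun _ => e.2,
    Subsingleton.strictMono _, Subsingleton.strictMono _, fun _ => he⟩)

theorem one_le_ex_one {l : ℕ} (hl : 2 ≤ l) (π : Equiv.Perm (Fin l)) : 1 ≤ ex π 1 := by
  have h : ¬ MatContains (fun _ _ : Fin 1 => true) (permMat π) := by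
    rw [matContains_permMat_iff]
    rintro ⟨c, -, hc, -⟩
    have := hc (show (⟨0, by omega⟩ : Fin l) < ⟨1, by omega⟩ by simp [Fin.lt_def])
    exact absurd this (by simp)
  refine le_trans ?_ (ones_le_ex h)
  simp [ones]

/-! ### Superadditivity -/

/-- `π` is a direct sum of two nonempty permutations. -/
def SumDecomposable {l : ℕ} (π : Equiv.Perm (Fin l)) : Prop :=
  ∃ s t : Set (Fin l), IsLowerSet s ∧ IsLowerSet t ∧ s.Nonempty ∧ sᶜ.Nonempty ∧
    ∀ i, i ∈ s ↔ π i ∈ t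

/-- A splitting of `π` puts the position of the least value into the lower set of positions and that
of the greatest value outside it. A splitting of the reverse does the opposite. Two lower sets of
positions are nested, so both cannot happen. -/
theorem not_sumDecomposable_or_rev {l : ℕ} (π : Equiv.Perm (Fin l)) :
    ¬ SumDecomposable π ∨ ¬ SumDecomposable (π.trans Fin.revPerm) := by
  by_contra! h
  obtain ⟨⟨s, t, hs, ht, ⟨x, hx⟩, ⟨x', hx'⟩, h⟩, u, v, hu, hv, ⟨y, hy⟩, ⟨y', hy'⟩, h'⟩ := h
  have hl : 0 < l := x.pos
  set a : Fin l := ⟨0, hl⟩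
  have ha : ∀ z : Fin l, a ≤ z := fun z => Fin.le_def.2 (Nat.zero_le _)
  set b : Fin l := Fin.rev a
  have hb : ∀ z : Fin l, z ≤ b := fun z => by
    simpa [b] using Fin.le_rev_iff.2 (ha _)
  have h1 : π.symm a ∈ s := (h _).2 (by simpa using ht (ha _) ((h x).1 hx))
  have h2 : π.symm b ∉ s := fun hc => hx' ((h x').2 (ht (hb _) (by simpa using (h _).1 hc)))
  have h3 : π.symm b ∈ u := (h' _).2 (by simpa [b] using hv (ha _) ((h' y).1 hy))
  have h4 : π.symm a ∉ u := fun hc =>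
    hy' ((h' y').2 (hv (hb _) (by simpa [b] using (h' _).1 hc)))
  rcases hs.total hu with hsu | hsu
  · exact h4 (hsu h1)
  · exact h2 (hsu h3)

theorem ex_le_ex_rev {l : ℕ} (π : Equiv.Perm (Fin l)) (n : ℕ) :
    ex π n ≤ ex (π.trans Fin.revPerm) n := by
  refine ex_le fun M hM => ?_
  have h : ¬ MatContains (fun i j => M i (Fin.rev j)) (permMat (π.trans Fin.revPerm)) := by
    rw [matContains_permMat_iff] at hM ⊢
    rintro ⟨c, r, hc, hr, h⟩
    exact hM ⟨c, fun j => Fin.rev (r (Fin.rev j)), hc,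
      fun a b hab => Fin.rev_lt_rev.2 (hr (Fin.rev_lt_rev.2 hab)), fun i => by simpa using h i⟩
  refine le_trans (le_of_eq ?_) (ones_le_ex h)
  refine Finset.card_bij (fun e _ => (e.1, Fin.rev e.2)) ?_ ?_ ?_
  · intro e he
    simpa using he
  · rintro ⟨a, b⟩ _ ⟨c, d⟩ _ h
    simpa using h
  · rintro ⟨a, b⟩ h
    exact ⟨(a, Fin.rev b), by simpa using h, by simp⟩

theorem ex_rev {l : ℕ} (π : Equiv.Perm (Fin l)) (n : ℕ) :
    ex (π.trans Fin.revPerm) n = ex π n := by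
  refine le_antisymm ((ex_le_ex_rev _ n).trans (le_of_eq ?_)) (ex_le_ex_rev π n)
  congr 1
  ext i
  simp

/-- Two extremal matrices are placed as diagonal blocks. A copy of `π` that meets both blocks would
exhibit `π` as a direct sum, so a copy lies in one block, which is impossible. -/
theorem ex_add_le_of_not_sumDecomposable {l : ℕ} (hl : 1 ≤ l) {π : Equiv.Perm (Fin l)}
    (hπ : ¬ SumDecomposable π) (a b : ℕ) : ex π a + ex π b ≤ ex π (a + b) := by
  obtain ⟨M, hM, hMa⟩ := exists_ones_eq_ex hl π a
  obtain ⟨N, hN, hNb⟩ := exists_ones_eq_ex hl π b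
  let D : Fin (a + b) → Fin (a + b) → Bool := fun i j =>
    if h : i.1 < a ∧ j.1 < a then M ⟨i, h.1⟩ ⟨j, h.2⟩
    else if h : a ≤ i.1 ∧ a ≤ j.1 then N ⟨i - a, by omega⟩ ⟨j - a, by omega⟩ else false
  have hD : ¬ MatContains D (permMat π) := by
    rw [matContains_permMat_iff] at hM hN ⊢
    rintro ⟨c, r, hc, hr, h⟩
    have key : ∀ i, (c i).1 < a ↔ (r (π i)).1 < a := by
      intro i
      have := h i
      simp only [D] at this
      split_ifs at this <;> omega
    by_cases h1 : ∃ i, (c i).1 < a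
    · by_cases h2 : ∃ i, ¬ (c i).1 < a
      · refine hπ ⟨{i | (c i).1 < a}, {j | (r j).1 < a}, ?_, ?_, h1, h2, key⟩
        · intro x y hxy hx
          exact lt_of_le_of_lt (Fin.le_def.1 (hc.monotone hxy)) hx
        · intro x y hxy hx
          exact lt_of_le_of_lt (Fin.le_def.1 (hr.monotone hxy)) hx
      · push Not at h2
        have h3 : ∀ j, (r j).1 < a := fun j => by simpa using (key (π.symm j)).1 (h2 _)
        refine hM ⟨fun i => ⟨c i, h2 i⟩, fun j => ⟨r j, h3 j⟩, fun x y hxy => hc hxy,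
          fun x y hxy => hr hxy, fun i => ?_⟩
        simpa [D, h2, h3] using h i
    · push Not at h1
      have h3 : ∀ j, a ≤ (r j).1 := fun j => by
        have := (key (π.symm j)).not.1 (not_lt.2 (h1 _))
        simpa using this
      refine hN ⟨fun i => ⟨c i - a, by have := h1 i; omega⟩,
          fun j => ⟨r j - a, by have := h3 j; omega⟩, fun x y hxy => ?_,
          fun x y hxy => ?_, fun i => ?_⟩
      · have h4 := Fin.lt_def.1 (hc hxy)
        have h5 := h1 x
        rw [Fin.lt_def]
        dsimp only
        omega
      · have h4 := Fin.lt_def.1 (hr hxy)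
        have h5 := h3 x
        rw [Fin.lt_def]
        dsimp only
        omega
      · have := h i
        simp only [D] at this
        rw [dif_neg (by have := h1 i; omega), dif_pos ⟨h1 i, h3 _⟩] at this
        exact this
  rw [← hMa, ← hNb]
  refine le_trans ?_ (ones_le_ex hD)
  unfold ones
  rw [← Finset.card_disjSum]
  refine Finset.card_le_card_of_injOn
    (Sum.elim (fun e => (Fin.castAdd b e.1, Fin.castAdd b e.2))
      (fun e => (Fin.natAdd a e.1, Fin.natAdd a e.2))) ?_ ?_
  · rintro (e | e) he
    · simpa [D] using he
    · simpa [D] using he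
  · rintro (⟨x, y⟩ | ⟨x, y⟩) _ (⟨z, w⟩ | ⟨z, w⟩) _ h <;>
      simp [Fin.ext_iff] at h ⊢ <;> omega

theorem ex_add_le {l : ℕ} (π : Equiv.Perm (Fin l)) (a b : ℕ) :
    ex π a + ex π b ≤ ex π (a + b) := by
  rcases Nat.lt_or_ge 1 l with hl | hl
  · rcases not_sumDecomposable_or_rev π with h | h
    · exact ex_add_le_of_not_sumDecomposable hl.le h a b
    · simpa only [ex_rev] using ex_add_le_of_not_sumDecomposable hl.le h a b
  · simp [ex_zero_of_length_le_one hl]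

theorem ex_mono {l : ℕ} (π : Equiv.Perm (Fin l)) : Monotone (ex π) := by
  intro a b hab
  obtain ⟨c, rfl⟩ := Nat.exists_eq_add_of_le hab
  exact le_trans (Nat.le_add_right _ _) (ex_add_le π a c)

/-! ### The Marcus–Tardos theorem -/

theorem monotone_divNat (q s : ℕ) : Monotone (Fin.divNat : Fin (q * s) → Fin q) :=
  fun _ _ h => Fin.le_def.2 (Nat.div_le_div_right (Fin.le_def.1 h))

open Classical in
/-- The positions, within a block of `s` consecutive columns, of the columns that have a 1-entry
in a given block. -/
noncomputable def blockCols {q s n p : ℕ} (g : Fin n → Fin p) (M : Fin (q * s) → Fin n → Bool)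
    (I : Fin q) (J : Fin p) : Finset (Fin s) :=
  Finset.univ.filter fun x => ∃ j, g j = J ∧ M (finProdFinEquiv (I, x)) j = true

theorem mem_blockCols {q s n p : ℕ} {g : Fin n → Fin p} {M : Fin (q * s) → Fin n → Bool}
    {I : Fin q} {J : Fin p} {x : Fin s} :
    x ∈ blockCols g M I J ↔ ∃ j, g j = J ∧ M (finProdFinEquiv (I, x)) j = true := by
  simp [blockCols]

/-- Pigeonhole over the `l`-subsets of column positions: with too many wide blocks in one strip, `l`
of them share the same `l` nonempty columns. Each of these columns then offers a 1-entry in each of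
the `l` blocks, and this is enough to build `π`. -/
theorem card_wide_le {q s n p l : ℕ} {g : Fin n → Fin p} (hg : Monotone g)
    {M : Fin (q * s) → Fin n → Bool} {π : Equiv.Perm (Fin l)}
    (hM : ¬ MatContains M (permMat π)) (I : Fin q) :
    (Finset.univ.filter fun J => l ≤ (blockCols g M I J).card).card ≤ s.choose l * l := by
  by_contra! h
  -- The empty set is a default for the blocks that are not wide.
  have hex : ∀ J, ∃ A : Finset (Fin s), l ≤ (blockCols g M I J).card →
      A ⊆ blockCols g M I J ∧ A.card = l := fun J => by
    by_cases hJ : l ≤ (blockCols g M I J).card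
    · obtain ⟨A, hA⟩ := Finset.exists_subset_card_eq hJ
      exact ⟨A, fun _ => hA⟩
    · exact ⟨∅, fun h => absurd h hJ⟩
  choose A hA using hex
  obtain ⟨B, hB, hlt⟩ := Finset.exists_lt_card_fiber_of_mul_lt_card_of_maps_to (f := A)
    (t := Finset.powersetCard l (Finset.univ : Finset (Fin s))) (n := l)
    (s := Finset.univ.filter fun J => l ≤ (blockCols g M I J).card)
    (fun J hJ => by
      simp only [Finset.mem_filter, Finset.mem_univ, true_and] at hJ
      simp [Finset.mem_powersetCard, (hA J hJ).2])
    (by simpa [Finset.card_powersetCard] using h)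
  have hBl : B.card = l := (Finset.mem_powersetCard.1 hB).2
  let r := Finset.orderEmbOfCardLe _ hlt.le
  let x := B.orderEmbOfFin hBl
  have hr : ∀ b, l ≤ (blockCols g M I (r b)).card ∧ A (r b) = B := fun b => by
    simpa using Finset.orderEmbOfCardLe_mem _ hlt.le b
  have hj : ∀ b a, ∃ j, g j = r b ∧ M (finProdFinEquiv (I, x a)) j = true := fun b a => by
    have h1 : x a ∈ A (r b) := by
      rw [(hr b).2]
      exact Finset.orderEmbOfFin_mem B hBl a
    exact mem_blockCols.1 ((hA _ (hr b).1).1 h1)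
  choose j hj hMj using hj
  refine hM (matContains_permMat_iff.2 ⟨fun a => finProdFinEquiv (I, x a),
    fun b => j b (π.symm b), fun a b hab => ?_, fun a b hab => ?_,
    fun a => by simpa using hMj (π a) a⟩)
  · have : x a < x b := x.strictMono hab
    rw [Fin.lt_def] at this ⊢
    simpa [finProdFinEquiv] using this
  · refine hg.reflect_lt ?_
    rw [hj, hj]
    exact r.strictMono hab

theorem not_matContains_transpose {m n l : ℕ} {M : Fin m → Fin n → Bool} {π : Equiv.Perm (Fin l)}
    (hM : ¬ MatContains M (permMat π)) :
    ¬ MatContains (fun j i => M i j) (permMat π.symm) := by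
  rw [matContains_permMat_iff] at hM ⊢
  rintro ⟨c, r, hc, hr, h⟩
  exact hM ⟨r, c, hr, hc, fun i => by simpa using h (π i)⟩

/-- The 1-entries are counted by blocks of side `s`. At most `ex π q` blocks are nonzero, and one
that is neither wide nor tall has at most `(l - 1) ^ 2` ones. A wide or tall block may be full, but
each strip contains few of them; tall blocks are the wide blocks of the transpose. -/
theorem ex_mul_le {l : ℕ} (π : Equiv.Perm (Fin l)) (q s : ℕ) :
    ex π (q * s) ≤ (l - 1) ^ 2 * ex π q + 2 * s ^ 2 * (s.choose l * l) * q := by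
  classical
  refine ex_le fun M hM => ?_
  let f : Fin (q * s) → Fin q := Fin.divNat
  have hf : Monotone f := monotone_divNat q s
  let B := contract f f M
  have hB : ¬ MatContains B (permMat π) := fun h => hM (h.of_contract hf hf)
  let N : Fin (q * s) → Fin (q * s) → Bool := fun j i => M i j
  have hN : ¬ MatContains N (permMat π.symm) := not_matContains_transpose hM
  let wide := Finset.univ.filter fun e : Fin q × Fin q => l ≤ (blockCols f M e.1 e.2).card
  let tall := Finset.univ.filter fun e : Fin q × Fin q => l ≤ (blockCols f N e.2 e.1).card
  have hwide : wide.card ≤ s.choose l * l * q := by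
    refine (Finset.card_le_mul_card_image_of_maps_to (f := Prod.fst) (t := Finset.univ)
      (by simp) (s.choose l * l) fun I _ => ?_).trans (by simp)
    refine le_trans (Finset.card_le_card_of_injOn Prod.snd ?_ ?_) (card_wide_le hf hM I)
    · rintro ⟨a, b⟩ h
      simp only [wide, Finset.coe_filter, Finset.mem_filter, Finset.mem_univ, true_and,
        Set.mem_ofPred_eq] at h ⊢
      exact h.2 ▸ h.1
    · rintro ⟨a, b⟩ h ⟨c, d⟩ h' hbd
      simp at h h' hbd
      rw [hbd, h.2, h'.2]
  have htall : tall.card ≤ s.choose l * l * q := by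
    refine (Finset.card_le_mul_card_image_of_maps_to (f := Prod.snd) (t := Finset.univ)
      (by simp) (s.choose l * l) fun I _ => ?_).trans (by simp)
    refine le_trans (Finset.card_le_card_of_injOn Prod.fst ?_ ?_) (card_wide_le hf hN I)
    · rintro ⟨a, b⟩ h
      simp only [tall, Finset.coe_filter, Finset.mem_filter, Finset.mem_univ, true_and,
        Set.mem_ofPred_eq] at h ⊢
      exact h.2 ▸ h.1
    · rintro ⟨a, b⟩ h ⟨c, d⟩ h' hbd
      simp at h h' hbd
      rw [hbd, h.2, h'.2]
  have hblock : ∀ e : Fin q × Fin q,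
      ((Finset.univ.filter fun e : Fin (q * s) × Fin (q * s) => M e.1 e.2 = true).filter
        fun x => (f x.1, f x.2) = e).card ≤
      (if B e.1 e.2 = true then (l - 1) ^ 2 else 0) + (if e ∈ wide then s ^ 2 else 0) +
        (if e ∈ tall then s ^ 2 else 0) := by
    rintro ⟨I, J⟩
    have h1 : ((Finset.univ.filter fun e : Fin (q * s) × Fin (q * s) => M e.1 e.2 = true).filter
        fun x => (f x.1, f x.2) = (I, J)).card ≤
        (blockCols f M I J).card * (blockCols f N J I).card := by
      rw [← Finset.card_product]
      refine Finset.card_le_card_of_injOn (fun x => (Fin.modNat x.1, Fin.modNat x.2)) ?_ ?_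
      · rintro ⟨x, y⟩ h
        simp only [Finset.coe_filter, Finset.mem_filter, Finset.mem_univ, true_and,
          Set.mem_ofPred_eq, Prod.mk.injEq] at h
        obtain ⟨hxy, hx, hy⟩ := h
        have ex : finProdFinEquiv (I, x.modNat) = x := by
          rw [← hx]; exact finProdFinEquiv.apply_symm_apply x
        have ey : finProdFinEquiv (J, y.modNat) = y := by
          rw [← hy]; exact finProdFinEquiv.apply_symm_apply y
        simp only [Finset.coe_product, Set.mem_prod, Finset.mem_coe, mem_blockCols]
        exact ⟨⟨y, hy, by rw [ex]; exact hxy⟩, ⟨x, hx, by rw [ey]; exact hxy⟩⟩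
      · rintro ⟨x, y⟩ h ⟨x', y'⟩ h' hm
        simp only [Finset.coe_filter, Finset.mem_filter, Finset.mem_univ, true_and,
          Set.mem_ofPred_eq, Prod.mk.injEq] at h h' hm ⊢
        constructor
        · exact finProdFinEquiv.symm.injective
            (Prod.ext (h.2.1.trans h'.2.1.symm) hm.1)
        · exact finProdFinEquiv.symm.injective
            (Prod.ext (h.2.2.trans h'.2.2.symm) hm.2)
    have hs : ∀ X : Finset (Fin s), X.card ≤ s := fun X => by simpa using X.card_le_univ
    by_cases hw : (I, J) ∈ wide
    · simp only [hw, if_true]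
      have := Nat.mul_le_mul (hs (blockCols f M I J)) (hs (blockCols f N J I))
      rw [← pow_two] at this
      exact (h1.trans this).trans (Nat.le_add_right_of_le (Nat.le_add_left _ _))
    by_cases ht : (I, J) ∈ tall
    · simp only [ht, if_true]
      have := Nat.mul_le_mul (hs (blockCols f M I J)) (hs (blockCols f N J I))
      rw [← pow_two] at this
      exact (h1.trans this).trans (Nat.le_add_left _ _)
    by_cases hBe : B I J = true
    · simp only [hBe, if_true]
      simp only [wide, tall, Finset.mem_filter, Finset.mem_univ, true_and, not_le] at hw ht
      have := Nat.mul_le_mul (Nat.le_sub_one_of_lt hw) (Nat.le_sub_one_of_lt ht)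
      rw [← pow_two] at this
      exact (h1.trans this).trans (Nat.le_add_right_of_le (Nat.le_add_right _ _))
    · refine le_trans (le_of_eq (Finset.card_eq_zero.2 ?_)) (Nat.zero_le _)
      refine Finset.eq_empty_of_forall_notMem ?_
      rintro ⟨x, y⟩ h
      simp only [Finset.mem_filter, Finset.mem_univ, true_and, Prod.mk.injEq] at h
      exact hBe (contract_apply.2 ⟨x, y, h.2.1, h.2.2, h.1⟩)
  have hsum := Finset.card_eq_sum_card_fiberwise
    (f := fun x : Fin (q * s) × Fin (q * s) => (f x.1, f x.2)) (t := Finset.univ)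
    (s := Finset.univ.filter fun e : Fin (q * s) × Fin (q * s) => M e.1 e.2 = true) (by simp)
  have hle := Finset.sum_le_sum fun e (_ : e ∈ (Finset.univ : Finset (Fin q × Fin q))) => hblock e
  rw [← hsum] at hle
  refine hle.trans ?_
  rw [Finset.sum_add_distrib, Finset.sum_add_distrib, ← Finset.sum_filter, Finset.sum_const,
    Finset.sum_ite_mem, Finset.sum_ite_mem, Finset.univ_inter, Finset.univ_inter,
    Finset.sum_const, Finset.sum_const]
  simp only [smul_eq_mul]
  have h1 : (Finset.univ.filter fun e : Fin q × Fin q => B e.1 e.2 = true).card ≤ ex π q :=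
    ones_le_ex hB
  nlinarith [Nat.mul_le_mul_right ((l - 1) ^ 2) h1, Nat.mul_le_mul_right (s ^ 2) hwide,
    Nat.mul_le_mul_right (s ^ 2) htall]

theorem exists_ex_le_mul {l : ℕ} (π : Equiv.Perm (Fin l)) : ∃ A : ℕ, ∀ n, ex π n ≤ A * n := by
  rcases Nat.lt_or_ge 1 l with hl | hl
  swap
  · exact ⟨0, fun n => by simp [ex_zero_of_length_le_one hl]⟩
  -- This choice gives `(l - 1) ^ 2 + 1 ≤ s`, so the recursion for `ex π (s ^ t) / s ^ t` stays
  -- bounded. Other values of `n` are rounded up to a power of `s`, at the cost of a factor `s`.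
  set s := l ^ 2 with hs
  have hs1 : 1 < s := by nlinarith
  set K := 2 * s ^ 2 * (s.choose l * l)
  have hpow : ∀ t, ex π (s ^ t) ≤ (K + 1) * s ^ t := by
    intro t
    induction t with
    | zero =>
      refine ex_le fun M _ => (ones_le_sq M).trans ?_
      simp
    | succ t ih =>
      rw [pow_succ]
      refine (ex_mul_le π (s ^ t) s).trans ?_
      have h1 : (l - 1) ^ 2 + 1 ≤ s := by
        obtain ⟨l', rfl⟩ := Nat.exists_eq_add_of_lt hl
        simp only [hs]
        have : 1 + l' + 1 - 1 = l' + 1 := by omega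
        rw [this]
        nlinarith
      calc (l - 1) ^ 2 * ex π (s ^ t) + K * s ^ t
          ≤ (l - 1) ^ 2 * ((K + 1) * s ^ t) + (K + 1) * s ^ t := by gcongr; omega
        _ = (K + 1) * s ^ t * ((l - 1) ^ 2 + 1) := by ring
        _ ≤ (K + 1) * s ^ t * s := by gcongr
        _ = _ := by ring
  refine ⟨(K + 1) * s, fun n => ?_⟩
  rcases Nat.eq_zero_or_pos n with rfl | hn
  · exact ex_le fun M _ => (ones_le_sq M).trans (by simp)
  calc ex π n ≤ ex π (s ^ (Nat.log s n + 1)) := ex_mono π (Nat.lt_pow_succ_log_self hs1 n).le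
    _ ≤ (K + 1) * s ^ (Nat.log s n + 1) := hpow _
    _ = (K + 1) * s * s ^ Nat.log s n := by ring
    _ ≤ (K + 1) * s * n := by gcongr; exact Nat.pow_log_le_self s hn.ne'

/-! ### The Füredi–Hajnal limit -/

theorem subadditive_neg_ex {l : ℕ} (π : Equiv.Perm (Fin l)) :
    Subadditive fun n => -(ex π n : ℝ) := fun a b => by
  have : (ex π a : ℝ) + ex π b ≤ ex π (a + b) := by exact_mod_cast ex_add_le π a b
  linarith

theorem bddBelow_neg_ex_div {l : ℕ} (π : Equiv.Perm (Fin l)) :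
    BddBelow (Set.range fun n : ℕ => -(ex π n : ℝ) / n) := by
  obtain ⟨A, hA⟩ := exists_ex_le_mul π
  refine ⟨-A, ?_⟩
  rintro _ ⟨n, rfl⟩
  have h : (ex π n : ℝ) ≤ A * n := by exact_mod_cast hA n
  have : (ex π n : ℝ) / n ≤ A := div_le_of_le_mul₀ (by positivity) (by positivity) h
  simp only [neg_div]
  linarith

theorem tendsto_ex_div_neg_lim {l : ℕ} (π : Equiv.Perm (Fin l)) :
    Tendsto (fun n : ℕ => (ex π n : ℝ) / n) atTop (𝓝 (-(subadditive_neg_ex π).lim)) := by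
  have h := ((subadditive_neg_ex π).tendsto_lim (bddBelow_neg_ex_div π)).neg
  simpa [neg_div] using h

theorem tendsto_furediHajnalLimit {l : ℕ} (π : Equiv.Perm (Fin l)) :
    Tendsto (fun n : ℕ => (ex π n : ℝ) / n) atTop (𝓝 (furediHajnalLimit π)) :=
  tendsto_nhds_limUnder ⟨_, tendsto_ex_div_neg_lim π⟩

/-- In Fekete's lemma the limit is the supremum of the ratios, so the bound holds for every `n`
without an error term. -/
theorem ex_le_furediHajnalLimit_mul {l : ℕ} (π : Equiv.Perm (Fin l)) (n : ℕ) :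
    (ex π n : ℝ) ≤ furediHajnalLimit π * n := by
  rcases Nat.eq_zero_or_pos n with rfl | hn
  · have : ex π 0 ≤ 0 := ex_le fun M _ => (ones_le_sq M).trans (by simp)
    simp [Nat.le_zero.1 this]
  have h := (subadditive_neg_ex π).lim_le_div (bddBelow_neg_ex_div π) hn.ne'
  have he := tendsto_nhds_unique (tendsto_furediHajnalLimit π) (tendsto_ex_div_neg_lim π)
  have hn' : (0 : ℝ) < n := by exact_mod_cast hn
  rw [he, ← div_le_iff₀ hn']
  rw [neg_div] at h
  linarith

theorem one_le_furediHajnalLimit {l : ℕ} (hl : 2 ≤ l) (π : Equiv.Perm (Fin l)) :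
    1 ≤ furediHajnalLimit π := by
  have h := ex_le_furediHajnalLimit_mul π 1
  have h1 : (1 : ℝ) ≤ ex π 1 := by exact_mod_cast one_le_ex_one hl π
  simp at h
  linarith

/-! ### Counting matrices and words that avoid a permutation -/

open Classical in
/-- The `n × n` binary matrices that avoid `π`. -/
noncomputable def avoidingMatrices {l : ℕ} (π : Equiv.Perm (Fin l)) (n : ℕ) :
    Finset (Fin n → Fin n → Bool) :=
  Finset.univ.filter fun M => ¬ MatContains M (permMat π)

open Classical in
/-- The words of length `k` over `Fin k` that avoid `π`. -/
noncomputable def avoidingWords {l : ℕ} (π : Equiv.Perm (Fin l)) (k : ℕ) :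
    Finset (Fin k → Fin k) :=
  Finset.univ.filter fun w => SeqAvoids w π

theorem mem_avoidingMatrices {l n : ℕ} {π : Equiv.Perm (Fin l)} {M : Fin n → Fin n → Bool} :
    M ∈ avoidingMatrices π n ↔ ¬ MatContains M (permMat π) := by
  simp [avoidingMatrices]

theorem mem_avoidingWords {l k : ℕ} {π : Equiv.Perm (Fin l)} {w : Fin k → Fin k} :
    w ∈ avoidingWords π k ↔ SeqAvoids w π := by
  simp [avoidingWords]

/-- Contraction by `2 × 2` blocks preserves avoidance. Given the contraction, all 1-entries lie in
its nonzero blocks, which have at most `4 * ex π n` cells in total, and any preimage is a subset of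
these cells. -/
theorem card_avoidingMatrices_mul_two_le {l : ℕ} (π : Equiv.Perm (Fin l)) (n : ℕ) :
    (avoidingMatrices π (n * 2)).card ≤ 16 ^ ex π n * (avoidingMatrices π n).card := by
  classical
  let f : Fin (n * 2) → Fin n := Fin.divNat
  have hf : Monotone f := monotone_divNat n 2
  refine Finset.card_le_mul_card_image_of_maps_to (f := contract f f) (fun M hM => ?_) _
    fun B hB => ?_
  · rw [mem_avoidingMatrices] at hM ⊢
    exact fun h => hM (h.of_contract hf hf)
  let Z := Finset.univ.filter fun e : Fin (n * 2) × Fin (n * 2) => B (f e.1) (f e.2) = true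
  have hZ : Z.card ≤ 4 * ones B := by
    refine Finset.card_le_mul_card_image_of_maps_to (f := fun e => (f e.1, f e.2)) ?_ 4 ?_
    · intro e he
      simpa [Z] using he
    · rintro ⟨I, J⟩ -
      have : 4 = (Finset.univ : Finset (Fin 2 × Fin 2)).card := by simp
      rw [this]
      refine Finset.card_le_card_of_injOn (fun x => (Fin.modNat x.1, Fin.modNat x.2)) (by simp) ?_
      rintro ⟨x, y⟩ h ⟨x', y'⟩ h' hm
      simp only [Finset.coe_filter, Set.mem_ofPred_eq, Prod.mk.injEq] at h h' hm ⊢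
      exact ⟨finProdFinEquiv.symm.injective (Prod.ext (h.2.1.trans h'.2.1.symm) hm.1),
        finProdFinEquiv.symm.injective (Prod.ext (h.2.2.trans h'.2.2.symm) hm.2)⟩
  calc _ ≤ Z.powerset.card := by
        refine Finset.card_le_card_of_injOn
          (fun M => Finset.univ.filter fun e : Fin (n * 2) × Fin (n * 2) => M e.1 e.2 = true) ?_ ?_
        · intro M hM
          simp only [Finset.coe_filter, Set.mem_ofPred_eq] at hM
          simp only [Finset.coe_powerset, Set.mem_preimage, Set.mem_powerset_iff,
            Finset.coe_subset]
          intro e he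
          simp only [Finset.mem_filter, Finset.mem_univ, true_and, Z] at he ⊢
          rw [← hM.2]
          exact contract_apply.2 ⟨_, _, rfl, rfl, he⟩
        · intro M _ M' _ h
          funext i j
          have := congrArg (fun s => (i, j) ∈ s) h
          simp only [Finset.mem_filter, Finset.mem_univ, true_and, eq_iff_iff] at this
          exact Bool.eq_iff_iff.2 this
    _ = 2 ^ Z.card := Finset.card_powerset _
    _ ≤ 2 ^ (4 * ex π n) := by
        gcongr
        · norm_num
        · exact hZ.trans (Nat.mul_le_mul_left 4 (ones_le_ex (mem_avoidingMatrices.1 hB)))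
    _ = 16 ^ ex π n := by rw [pow_mul]; norm_num

theorem card_avoidingMatrices_two_pow_le {l A : ℕ} {π : Equiv.Perm (Fin l)} (hA : 1 ≤ A)
    (h : ∀ n, ex π n ≤ A * n) (t : ℕ) :
    (avoidingMatrices π (2 ^ t)).card ≤ 16 ^ (A * 2 ^ t) := by
  induction t with
  | zero =>
    refine (Finset.card_le_univ _).trans ?_
    simp only [pow_zero, Fintype.card_pi, Fintype.card_bool, Finset.prod_const, Finset.card_univ,
      Fintype.card_fin, pow_one, mul_one]
    calc 2 ≤ 16 ^ 1 := by norm_num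
      _ ≤ 16 ^ A := Nat.pow_le_pow_right (by norm_num) hA
  | succ t ih =>
    rw [pow_succ]
    refine (card_avoidingMatrices_mul_two_le π (2 ^ t)).trans ?_
    calc _ ≤ 16 ^ (A * 2 ^ t) * 16 ^ (A * 2 ^ t) := by
          gcongr
          · norm_num
          · exact h _
      _ = _ := by rw [← pow_add]; congr 1; ring

/-- The matrix with a 1-entry in column `i` and row `w i`. -/
def wordMatrix {k n : ℕ} (w : Fin k → Fin n) : Fin k → Fin n → Bool :=
  fun i j => decide (w i = j)

theorem SeqAvoids.not_matContains_wordMatrix {k n l : ℕ} {w : Fin k → Fin n}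
    {π : Equiv.Perm (Fin l)} (h : SeqAvoids w π) : ¬ MatContains (wordMatrix w) (permMat π) := by
  intro hc
  obtain ⟨c, r, hc, hr, hw⟩ := matContains_permMat_iff.1 hc
  refine h ⟨OrderEmbedding.ofStrictMono c hc, fun a b => ?_⟩
  have hw' : ∀ a, w (c a) = r (π a) := fun a => by simpa [wordMatrix] using hw a
  simp [hw', hr.lt_iff_lt]

theorem card_blocks_le {k b q : ℕ} (hb : 1 ≤ b) {f : Fin k → Fin q} (hf : ∀ i, (f i).1 = i / b)
    (J : Fin q) : (Finset.univ.filter fun i => f i = J).card ≤ b := by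
  calc _ ≤ (Finset.range b).card := by
        refine Finset.card_le_card_of_injOn (fun i => i.1 % b) ?_ ?_
        · intro i _
          simpa using Nat.mod_lt _ hb
        · intro i hi j hj hij
          simp only [Finset.coe_filter, Finset.mem_univ, true_and, Set.mem_ofPred_eq] at hi hj hij
          have h1 : i.1 / b = j.1 / b := by rw [← hf, ← hf, hi, hj]
          apply Fin.ext
          rw [← Nat.div_add_mod i.1 b, ← Nat.div_add_mod j.1 b, h1, hij]
    _ = b := by simp

/-- Replacing a factor by a power of two turns a product of column degrees into a sum of exponents,
which the number of 1-entries controls. -/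
theorem le_mul_two_pow_div {A : ℕ} (hA : 1 ≤ A) (x : ℕ) : x ≤ A * 2 ^ (x / A) := by
  have h1 := Nat.lt_mul_div_succ x (by omega : 0 < A)
  exact h1.le.trans (Nat.mul_le_mul_left A Nat.lt_two_pow_self)

/-- The value at position `i` must lie in one of the nonzero blocks of the block column of `i`,
which leaves at most `A * deg` choices. The product over all positions is bounded by
`le_mul_two_pow_div`: each block column contains at most `A` positions, so the quotients `deg / A`
sum to at most `ones B`. -/
theorem card_words_contract_le {k q A : ℕ} (hA : 1 ≤ A) {f : Fin k → Fin q}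
    (hf : ∀ i, (f i).1 = i / A) {B : Fin q → Fin q → Bool} (hB : ones B ≤ A * q)
    (W : Finset (Fin k → Fin k)) (hW : ∀ w ∈ W, contract f f (wordMatrix w) = B) :
    W.card ≤ A ^ (2 * k) * 2 ^ (A * q) := by
  classical
  let deg : Fin q → ℕ := fun I => (Finset.univ.filter fun J => B I J = true).card
  have hdeg : ∑ I, deg I = ones B := by
    simp only [deg, ones, Finset.card_filter]
    rw [← Finset.univ_product_univ, Finset.sum_product]
  have hsub : W ⊆ Fintype.piFinset fun i => Finset.univ.filter fun j => B (f i) (f j) = true := by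
    intro w hw
    simp only [Fintype.mem_piFinset, Finset.mem_filter, Finset.mem_univ, true_and]
    intro i
    rw [← hW w hw]
    exact contract_apply.2 ⟨i, w i, rfl, rfl, by simp [wordMatrix]⟩
  have hcol : ∀ i, (Finset.univ.filter fun j => B (f i) (f j) = true).card ≤
      A ^ 2 * 2 ^ (deg (f i) / A) := by
    intro i
    calc _ ≤ A * deg (f i) := by
          refine Finset.card_le_mul_card_image_of_maps_to (f := f) ?_ A ?_
          · intro j hj
            simpa using hj
          · intro J _
            refine le_trans (Finset.card_le_card ?_) (card_blocks_le hA hf J)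
            intro j hj
            simp only [Finset.mem_filter] at hj ⊢
            exact ⟨Finset.mem_univ _, hj.2⟩
      _ ≤ A * (A * 2 ^ (deg (f i) / A)) := Nat.mul_le_mul_left A (le_mul_two_pow_div hA _)
      _ = _ := by ring
  have hsum : ∑ i, deg (f i) / A ≤ A * q := by
    calc ∑ i, deg (f i) / A = ∑ I, ∑ i with f i = I, deg (f i) / A :=
          (Finset.sum_fiberwise _ _ _).symm
      _ ≤ ∑ I, deg I := by
          refine Finset.sum_le_sum fun I _ => ?_
          calc _ = ∑ i with f i = I, deg I / A :=
                Finset.sum_congr rfl fun i hi => by rw [(Finset.mem_filter.1 hi).2]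
            _ = (Finset.univ.filter fun i => f i = I).card * (deg I / A) := by simp
            _ ≤ A * (deg I / A) := Nat.mul_le_mul_right _ (card_blocks_le hA hf I)
            _ ≤ deg I := Nat.mul_div_le _ _
      _ = ones B := hdeg
      _ ≤ A * q := hB
  calc W.card ≤ _ := Finset.card_le_card hsub
    _ = ∏ i, (Finset.univ.filter fun j => B (f i) (f j) = true).card := Fintype.card_piFinset _
    _ ≤ ∏ i, A ^ 2 * 2 ^ (deg (f i) / A) := Finset.prod_le_prod' fun i _ => hcol i
    _ = A ^ (2 * k) * 2 ^ ∑ i, deg (f i) / A := by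
        rw [Finset.prod_mul_distrib, Finset.prod_const, Finset.card_univ, Fintype.card_fin,
          ← pow_mul, Finset.prod_pow_eq_pow_sum]
    _ ≤ _ := by gcongr; norm_num

theorem card_avoidingWords_le_pow_self {l : ℕ} (π : Equiv.Perm (Fin l)) (k : ℕ) :
    (avoidingWords π k).card ≤ k ^ k :=
  (Finset.card_le_univ _).trans (by simp)

/-- The least `t` with `k ≤ 2 ^ t * A` overshoots by at most a factor of two. -/
theorem exists_two_pow_mul {A k : ℕ} (hA : 1 ≤ A) (hAk : A ≤ k) :
    ∃ t, k ≤ 2 ^ t * A ∧ A * 2 ^ t ≤ 2 * k := by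
  have hex : ∃ t, k ≤ 2 ^ t * A := ⟨k, Nat.lt_two_pow_self.le.trans (Nat.le_mul_of_pos_right _ hA)⟩
  classical
  refine ⟨Nat.find hex, Nat.find_spec hex, ?_⟩
  rcases h : Nat.find hex with _ | t
  · omega
  · have := Nat.find_min hex (m := t) (by omega)
    rw [pow_succ]
    nlinarith

/-- The number of words of length `k` avoiding `π` is at most `(32 A) ^ (2 k)`, for every linear
bound `A` on the extremal function. -/
theorem card_avoidingWords_le {l A : ℕ} {π : Equiv.Perm (Fin l)} (hA : 1 ≤ A)
    (h : ∀ n, ex π n ≤ A * n) (k : ℕ) :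
    (avoidingWords π k).card ≤ 2 ^ (10 * k) * A ^ (2 * k) := by
  classical
  rcases Nat.lt_or_ge k A with hk | hk
  -- Blocks of side `A` are useless if `A` exceeds `k`, but then the trivial bound suffices.
  · calc _ ≤ k ^ k := card_avoidingWords_le_pow_self π k
      _ ≤ A ^ k := Nat.pow_le_pow_left hk.le k
      _ ≤ A ^ (2 * k) := Nat.pow_le_pow_right hA (by omega)
      _ ≤ _ := Nat.le_mul_of_pos_left _ (by positivity)
  obtain ⟨t, ht, ht'⟩ := exists_two_pow_mul hA hk
  let f : Fin k → Fin (2 ^ t) := fun i => ⟨i / A, (Nat.div_lt_iff_lt_mul hA).2 (i.2.trans_le ht)⟩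
  have hf : Monotone f := fun i j hij => Fin.le_def.2 (Nat.div_le_div_right hij)
  have hcard := Finset.card_le_mul_card_image_of_maps_to (s := avoidingWords π k)
    (f := fun w => contract f f (wordMatrix w)) (t := avoidingMatrices π (2 ^ t))
    (fun w hw => mem_avoidingMatrices.2 fun hc =>
      (mem_avoidingWords.1 hw).not_matContains_wordMatrix (hc.of_contract hf hf))
    (A ^ (2 * k) * 2 ^ (A * 2 ^ t)) fun B hB =>
      card_words_contract_le hA (f := f) (fun _ => rfl)
        ((ones_le_ex (mem_avoidingMatrices.1 hB)).trans (h _)) _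
        fun w hw => (Finset.mem_filter.1 hw).2
  -- The two exponential factors combine to `2 ^ (5 * (A * 2 ^ t))`, and `A * 2 ^ t ≤ 2 * k` turns
  -- this into `2 ^ (10 * k)`.
  calc _ ≤ A ^ (2 * k) * 2 ^ (A * 2 ^ t) * 16 ^ (A * 2 ^ t) :=
        hcard.trans (Nat.mul_le_mul_left _ (card_avoidingMatrices_two_pow_le hA h t))
    _ = A ^ (2 * k) * 2 ^ (5 * (A * 2 ^ t)) := by
        rw [show (16 : ℕ) = 2 ^ 4 by norm_num, ← pow_mul, mul_assoc, ← pow_add]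
        congr 2; ring
    _ ≤ A ^ (2 * k) * 2 ^ (10 * k) :=
        Nat.mul_le_mul_left _ (Nat.pow_le_pow_right (by norm_num) (by linarith))
    _ = _ := mul_comm _ _

/-! ### Decision trees -/

/-- `σ` lists the positions of the word `w` by increasing value, equal values by increasing
position. -/
def StableSorts {β : Type*} [LinearOrder β] {k : ℕ} (w : Fin k → β) (σ : Fin k → Fin k) : Prop :=
  ∀ a b, a < b → w (σ a) < w (σ b) ∨ w (σ a) = w (σ b) ∧ σ a < σ b

/-- Some decision tree of depth `d` sorts all the words of `V`. -/
def Sortable {β : Type*} [LinearOrder β] {k : ℕ} : ℕ → Set (Fin k → β) → Prop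
  | 0, V => ∃ σ : Fin k → Fin k, ∀ w ∈ V, StableSorts w σ
  | d + 1, V => ∃ a b : Fin k,
      Sortable d {w | w ∈ V ∧ w a ≤ w b} ∧ Sortable d {w | w ∈ V ∧ ¬ w a ≤ w b}

section

variable {β : Type*} [LinearOrder β] {k : ℕ}

theorem Sortable.subset {d : ℕ} {U V : Set (Fin k → β)} (h : Sortable d V) (hUV : U ⊆ V) :
    Sortable d U := by
  induction d generalizing U V with
  | zero =>
    obtain ⟨σ, hσ⟩ := h
    exact ⟨σ, fun w hw => hσ w (hUV hw)⟩
  | succ d ih =>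
    obtain ⟨a, b, h1, h2⟩ := h
    exact ⟨a, b, ih h1 fun w hw => ⟨hUV hw.1, hw.2⟩, ih h2 fun w hw => ⟨hUV hw.1, hw.2⟩⟩

theorem sortable_empty (hk : 0 < k) (d : ℕ) : Sortable d (∅ : Set (Fin k → β)) := by
  induction d with
  | zero => exact ⟨id, by simp⟩
  | succ d ih =>
    exact ⟨⟨0, hk⟩, ⟨0, hk⟩, ih.subset fun w hw => hw.1, ih.subset fun w hw => hw.1⟩

theorem Sortable.mono (hk : 0 < k) {d e : ℕ} {V : Set (Fin k → β)} (h : Sortable d V)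
    (hde : d ≤ e) : Sortable e V := by
  induction e, hde using Nat.le_induction with
  | base => exact h
  | succ e _ ih =>
    exact ⟨⟨0, hk⟩, ⟨0, hk⟩, ih.subset fun w hw => hw.1,
      (sortable_empty hk e).subset fun w hw => hw.2 le_rfl⟩

/-- The property `P` of the words of `V` is decided by one comparison. -/
def Decides (V : Set (Fin k → β)) (P : (Fin k → β) → Prop) : Prop :=
  ∃ a b, (∀ w ∈ V, P w ↔ w a ≤ w b) ∨ ∀ w ∈ V, P w ↔ ¬ w a ≤ w b

theorem Sortable.of_decides {d : ℕ} {V : Set (Fin k → β)} {P : (Fin k → β) → Prop}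
    (hP : Decides V P) (h1 : Sortable d {w | w ∈ V ∧ P w}) (h2 : Sortable d {w | w ∈ V ∧ ¬ P w}) :
    Sortable (d + 1) V := by
  obtain ⟨a, b, h | h⟩ := hP
  · refine ⟨a, b, h1.subset fun w hw => ⟨hw.1, (h w hw.1).2 hw.2⟩,
      h2.subset fun w hw => ⟨hw.1, (h w hw.1).not.2 hw.2⟩⟩
  · refine ⟨a, b, h2.subset fun w hw => ⟨hw.1, (h w hw.1).not.2 (not_not.2 hw.2)⟩,
      h1.subset fun w hw => ⟨hw.1, (h w hw.1).2 hw.2⟩⟩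

/-- The words of `V` have the same stable order on their first `i` positions. -/
def AgreeBelow (i : ℕ) (V : Set (Fin k → β)) : Prop :=
  ∀ w ∈ V, ∀ w' ∈ V, ∀ a b : Fin k, a < b → b.1 < i → (w a ≤ w b ↔ w' a ≤ w' b)

theorem AgreeBelow.subset {i : ℕ} {U V : Set (Fin k → β)} (h : AgreeBelow i V) (hUV : U ⊆ V) :
    AgreeBelow i U :=
  fun w hw w' hw' => h w (hUV hw) w' (hUV hw')

theorem AgreeBelow.sortable_zero {V : Set (Fin k → β)} (h : AgreeBelow k V) : Sortable 0 V := by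
  rcases V.eq_empty_or_nonempty with rfl | ⟨w₀, hw₀⟩
  · exact ⟨id, by simp⟩
  obtain ⟨hm, hs⟩ := Tuple.eq_sort_iff.1 (rfl : Tuple.sort w₀ = Tuple.sort w₀)
  refine ⟨Tuple.sort w₀, fun w hw a b hab => ?_⟩
  set x := Tuple.sort w₀ a
  set y := Tuple.sort w₀ b
  have hxy : w₀ x ≤ w₀ y := hm hab.le
  have hne : x ≠ y := fun h => hab.ne ((Tuple.sort w₀).injective h)
  rcases lt_or_gt_of_ne hne with hlt | hlt
  · have := (h w₀ hw₀ w hw x y hlt y.2).1 hxy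
    rcases this.lt_or_eq with h | h
    · exact Or.inl h
    · exact Or.inr ⟨h, hlt⟩
  · refine Or.inl (not_le.1 fun hc => ?_)
    have h1 := (h w₀ hw₀ w hw y x hlt x.2).2 hc
    exact absurd (hs a b hab (le_antisymm hxy h1)) (not_lt.2 hlt.le)

/-! ### Inserting the next position into the common order -/

/-- The positions before `i` whose values are at most the value at `i`. -/
def lowerPart (i : Fin k) (w : Fin k → β) : Finset (Fin k) :=
  Finset.univ.filter fun j => j < i ∧ w j ≤ w i

theorem mem_lowerPart {i j : Fin k} {w : Fin k → β} : j ∈ lowerPart i w ↔ j < i ∧ w j ≤ w i := by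
  simp [lowerPart]

/-- The stable order of the positions of `w`. -/
def StableLT (w : Fin k → β) (a b : Fin k) : Prop :=
  w a < w b ∨ w a = w b ∧ a < b

theorem StableLT.iff_of_agree {i : ℕ} {V : Set (Fin k → β)} (h : AgreeBelow i V)
    {w w' : Fin k → β} (hw : w ∈ V) (hw' : w' ∈ V) {a b : Fin k} (ha : a.1 < i) (hb : b.1 < i) :
    StableLT w a b ↔ StableLT w' a b := by
  have key : ∀ v : Fin k → β, StableLT v a b ↔ (a < b ∧ v a ≤ v b) ∨ (b < a ∧ ¬ v b ≤ v a) := by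
    intro v
    unfold StableLT
    rcases lt_trichotomy a b with hab | rfl | hab
    · simp [hab, hab.not_gt, le_iff_lt_or_eq]
    · simp
    · simp [hab, hab.not_gt]
  rw [key, key]
  refine or_congr (and_congr_right fun hab => h w hw w' hw' a b hab hb)
    (and_congr_right fun hab => (h w hw w' hw' b a hab ha).not)

theorem stableLT_trichotomy (w : Fin k → β) (a b : Fin k) :
    StableLT w a b ∨ a = b ∨ StableLT w b a := by
  unfold StableLT
  rcases lt_trichotomy (w a) (w b) with h | h | h
  · simp [h]
  · rcases lt_trichotomy a b with h' | h' | h' <;> simp [h, h']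
  · simp [h]

theorem StableLT.le {w : Fin k → β} {a b : Fin k} (h : StableLT w a b) : w a ≤ w b :=
  h.elim le_of_lt fun h => h.1.le

/-- All words of `V` order the positions before `i` in the same stable way, and each lower part is
an initial segment of that common order. Lower parts are therefore nested, and their cardinality
encodes the insertion place of `i`. -/
theorem lowerPart_closed {V : Set (Fin k → β)} {i : Fin k} (h : AgreeBelow i V)
    {w w' : Fin k → β} (hw : w ∈ V) (hw' : w' ∈ V) {a b : Fin k} (hb : b ∈ lowerPart i w)
    (ha : a < i) (hab : StableLT w' a b) : a ∈ lowerPart i w := by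
  rw [mem_lowerPart] at hb ⊢
  have := (StableLT.iff_of_agree h hw' hw ha hb.1).1 hab
  exact ⟨ha, this.le.trans hb.2⟩

theorem lowerPart_subset_total {V : Set (Fin k → β)} {i : Fin k} (h : AgreeBelow i V)
    {w w' : Fin k → β} (hw : w ∈ V) (hw' : w' ∈ V) :
    lowerPart i w ⊆ lowerPart i w' ∨ lowerPart i w' ⊆ lowerPart i w := by
  by_contra! hc
  obtain ⟨a, ha, ha'⟩ := Finset.not_subset.1 hc.1
  obtain ⟨b, hb, hb'⟩ := Finset.not_subset.1 hc.2
  rcases stableLT_trichotomy w a b with hab | rfl | hab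
  · exact ha' (lowerPart_closed h hw' hw hb (mem_lowerPart.1 ha).1 hab)
  · exact ha' hb
  · exact hb' (lowerPart_closed h hw hw ha (mem_lowerPart.1 hb).1 hab)

theorem exists_stableLT_minimal (w : Fin k → β) {s : Finset (Fin k)} (hs : s.Nonempty) :
    ∃ a ∈ s, ∀ b ∈ s, b ≠ a → StableLT w a b := by
  obtain ⟨a, ha, hmin⟩ := s.exists_min_image (fun a => toLex (w a, a)) hs
  refine ⟨a, ha, fun b hb hne => ?_⟩
  have := hmin b hb
  rw [Prod.Lex.toLex_le_toLex] at this
  rcases this with h | ⟨h, h'⟩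
  · exact Or.inl h
  · exact Or.inr ⟨h, lt_of_le_of_ne h' hne.symm⟩

theorem exists_stableLT_maximal (w : Fin k → β) {s : Finset (Fin k)} (hs : s.Nonempty) :
    ∃ a ∈ s, ∀ b ∈ s, b ≠ a → StableLT w b a := by
  obtain ⟨a, ha, hmax⟩ := s.exists_max_image (fun a => toLex (w a, a)) hs
  refine ⟨a, ha, fun b hb hne => ?_⟩
  have := hmax b hb
  rw [Prod.Lex.toLex_le_toLex] at this
  rcases this with h | ⟨h, h'⟩
  · exact Or.inl h
  · exact Or.inr ⟨h, lt_of_le_of_ne h' hne⟩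

/-- The comparison is between `i` and the first position, in stable order, outside the lower part of
`w₀`: by nestedness a lower part is larger exactly if it contains that position. -/
theorem decides_lowerPart_gt {V : Set (Fin k → β)} {i : Fin k} (h : AgreeBelow i V)
    {w₀ : Fin k → β} (hw₀ : w₀ ∈ V) :
    Decides V fun w => (lowerPart i w₀).card < (lowerPart i w).card := by
  rcases (Finset.univ.filter fun j => j < i ∧ j ∉ lowerPart i w₀).eq_empty_or_nonempty with he | hne
  -- No lower part can be larger here; the failure of `w i ≤ w i` expresses the false property.
  · refine ⟨i, i, Or.inr fun w hw => ?_⟩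
    simp only [le_refl, not_true, iff_false, not_lt]
    refine Finset.card_le_card fun j hj => ?_
    by_contra hc
    have : j ∈ (∅ : Finset (Fin k)) := by
      rw [← he]
      simp [hc, (mem_lowerPart.1 hj).1]
    simp at this
  · obtain ⟨a, ha, hmin⟩ := exists_stableLT_minimal w₀ hne
    simp only [Finset.mem_filter, Finset.mem_univ, true_and] at ha hmin
    refine ⟨a, i, Or.inl fun w hw => ⟨fun hlt => ?_, fun hle => ?_⟩⟩
    · obtain ⟨b, hb, hb'⟩ := Finset.exists_mem_notMem_of_card_lt_card hlt
      by_cases hba : b = a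
      · exact hba ▸ (mem_lowerPart.1 hb).2
      · exact (mem_lowerPart.1 (lowerPart_closed h hw hw₀ hb ha.1
          (hmin b ⟨(mem_lowerPart.1 hb).1, hb'⟩ hba))).2
    · have haw : a ∈ lowerPart i w := mem_lowerPart.2 ⟨ha.1, hle⟩
      rcases lowerPart_subset_total h hw hw₀ with hs | hs
      · exact absurd (hs haw) ha.2
      · exact Finset.card_lt_card ⟨hs, fun hc => ha.2 (hc haw)⟩

/-- Dually, `i` is compared with the last position inside the lower part of `w₀`, which a smaller
lower part must miss. -/
theorem decides_lowerPart_lt {V : Set (Fin k → β)} {i : Fin k} (h : AgreeBelow i V)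
    {w₀ : Fin k → β} (hw₀ : w₀ ∈ V) :
    Decides V fun w => (lowerPart i w).card < (lowerPart i w₀).card := by
  rcases (lowerPart i w₀).eq_empty_or_nonempty with he | hne
  · exact ⟨i, i, Or.inr fun w hw => by simp [he]⟩
  · obtain ⟨a, ha, hmax⟩ := exists_stableLT_maximal w₀ hne
    have hai := (mem_lowerPart.1 ha).1
    refine ⟨a, i, Or.inr fun w hw => ⟨fun hlt hle => ?_, fun hle => ?_⟩⟩
    · have haw : a ∈ lowerPart i w := mem_lowerPart.2 ⟨hai, hle⟩
      obtain ⟨b, hb, hb'⟩ := Finset.exists_mem_notMem_of_card_lt_card hlt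
      refine hb' ?_
      by_cases hba : b = a
      · exact hba ▸ haw
      · exact lowerPart_closed h hw hw₀ haw (mem_lowerPart.1 hb).1 (hmax b hb hba)
    · have haw : a ∉ lowerPart i w := fun hc => hle (mem_lowerPart.1 hc).2
      rcases lowerPart_subset_total h hw hw₀ with hs | hs
      · exact Finset.card_lt_card ⟨hs, fun hc => haw (hc ha)⟩
      · exact absurd (hs ha) haw

theorem AgreeBelow.succ {V : Set (Fin k → β)} {i : Fin k} (h : AgreeBelow i V)
    (hc : ∀ w ∈ V, ∀ w' ∈ V, (lowerPart i w).card = (lowerPart i w').card) :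
    AgreeBelow (i + 1) V := by
  intro w hw w' hw' a b hab hb
  rcases Nat.lt_succ_iff_lt_or_eq.1 hb with hb | hb
  · exact h w hw w' hw' a b hab hb
  · obtain rfl : b = i := Fin.ext hb
    have heq : lowerPart b w = lowerPart b w' := by
      rcases lowerPart_subset_total h hw hw' with hs | hs
      · exact Finset.eq_of_subset_of_card_le hs (hc w hw w' hw').ge
      · exact (Finset.eq_of_subset_of_card_le hs (hc w hw w' hw').le).symm
    have := congrArg (a ∈ ·) heq
    simpa [mem_lowerPart, hab] using this

theorem exists_median {ι : Type*} {V : Finset ι} (hV : V.Nonempty) (g : ι → ℕ) :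
    ∃ w₀ ∈ V, 2 * (V.filter fun w => g w < g w₀).card ≤ V.card ∧
      2 * (V.filter fun w => g w₀ < g w).card ≤ V.card := by
  obtain ⟨z, hz, hzmax⟩ := V.exists_max_image g hV
  -- The median is the least value with at most half of `V` strictly above it. The next smaller
  -- value has more than half above it, so fewer than half lie strictly below the median.
  let U := V.filter fun w => 2 * (V.filter fun v => g w < g v).card ≤ V.card
  have hU : U.Nonempty := ⟨z, Finset.mem_filter.2 ⟨hz, by
    rw [Finset.filter_eq_empty_iff.2 fun v hv => not_lt.2 (hzmax v hv)]
    simp⟩⟩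
  obtain ⟨w₀, hw₀, hmin⟩ := U.exists_min_image g hU
  have hw₀' := Finset.mem_filter.1 hw₀
  refine ⟨w₀, hw₀'.1, ?_, hw₀'.2⟩
  rcases (V.filter fun w => g w < g w₀).eq_empty_or_nonempty with he | hne
  · simp [he]
  obtain ⟨w₁, hw₁, hmax⟩ := (V.filter fun w => g w < g w₀).exists_max_image g hne
  have hw₁' := Finset.mem_filter.1 hw₁
  have hnot : ¬ 2 * (V.filter fun v => g w₁ < g v).card ≤ V.card := fun hc =>
    absurd (hmin w₁ (Finset.mem_filter.2 ⟨hw₁'.1, hc⟩)) (not_le.2 hw₁'.2)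
  have hsub : (V.filter fun w => g w < g w₀) ⊆ V.filter fun v => ¬ g w₁ < g v := fun v hv =>
    Finset.mem_filter.2 ⟨(Finset.mem_filter.1 hv).1, not_lt.2 (hmax v hv)⟩
  have h1 := Finset.card_le_card hsub
  have h2 := Finset.card_filter_add_card_filter_not (s := V) (fun v => g w₁ < g v)
  omega

/-- The potential `2 * ((k - i) + Nat.log 2 V.card)` pays for the comparisons. Asking whether the
insertion place of `i` lies above or below the median leaves either at most half of the words or
words that all agree on the place. Either way two units are released; the branch that needs one
comparison is padded. -/
theorem sortable_of_agreeBelow (hk : 0 < k) (D : ℕ) : ∀ (i : ℕ) (V : Finset (Fin k → β)), i ≤ k →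
    AgreeBelow i (V : Set (Fin k → β)) → 2 * ((k - i) + Nat.log 2 V.card) ≤ D →
      Sortable D (V : Set (Fin k → β)) := by
  induction D using Nat.strong_induction_on with
  | _ D ih =>
    intro i V hik h hD
    rcases V.eq_empty_or_nonempty with rfl | hV
    · simpa using sortable_empty hk D
    rcases hik.eq_or_lt with rfl | hik
    · exact h.sortable_zero.mono hk (Nat.zero_le _)
    obtain ⟨D, rfl⟩ : ∃ D', D = D' + 2 := ⟨D - 2, by omega⟩
    let p : Fin k := ⟨i, hik⟩
    obtain ⟨w₀, hw₀, hlt, hgt⟩ := exists_median hV fun w => (lowerPart p w).card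
    have half : ∀ U : Finset (Fin k → β), U ⊆ V → 2 * U.card ≤ V.card →
        Sortable D (U : Set (Fin k → β)) := by
      intro U hUV hcard
      rcases U.eq_empty_or_nonempty with rfl | hU
      · simpa using sortable_empty hk D
      refine ih D (by omega) i U hik.le (h.subset (by exact_mod_cast hUV)) ?_
      have h1 : Nat.log 2 (U.card * 2) ≤ Nat.log 2 V.card := Nat.log_mono_right (by omega)
      rw [Nat.log_mul_base (by norm_num) (Finset.card_pos.2 hU).ne'] at h1
      omega
    have hw₀' : w₀ ∈ (V : Set (Fin k → β)) := hw₀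
    refine Sortable.of_decides (decides_lowerPart_gt (i := p) h hw₀') ?_ ?_
    · refine ((half _ (Finset.filter_subset _ _) hgt).mono hk (Nat.le_succ D)).subset ?_
      intro w hw
      simpa using hw
    · set V' : Set (Fin k → β) :=
        {w | w ∈ (V : Set (Fin k → β)) ∧ ¬ (lowerPart p w₀).card < (lowerPart p w).card}
      have hV' : V' ⊆ V := fun w hw => hw.1
      refine Sortable.of_decides (decides_lowerPart_lt (i := p) (h.subset hV')
        ⟨hw₀', lt_irrefl _⟩) ?_ ?_
      · refine (half _ (Finset.filter_subset _ _) hlt).subset ?_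
        intro w hw
        simpa using ⟨hw.1.1, hw.2⟩
      · let U := V.filter fun w => (lowerPart p w).card = (lowerPart p w₀).card
        have hU : U ⊆ V := Finset.filter_subset _ _
        have hUc : ∀ w ∈ (U : Set (Fin k → β)), (lowerPart p w).card = (lowerPart p w₀).card :=
          fun w hw => (Finset.mem_filter.1 hw).2
        refine (ih D (by omega) (i + 1) U hik
          ((h.subset (by exact_mod_cast hU)).succ (i := p)
            fun w hw w' hw' => (hUc w hw).trans (hUc w' hw').symm) ?_).subset ?_
        · have := Nat.log_mono_right (b := 2) (Finset.card_le_card hU)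
          omega
        · intro w hw
          exact Finset.mem_coe.2 (Finset.mem_filter.2 ⟨hw.1.1,
            le_antisymm (not_lt.1 hw.1.2) (not_lt.1 hw.2)⟩)

/-- Every finite set `V` of words is sorted by a decision tree of depth `2 (k + log |V|)`. -/
theorem sortable_finset (hk : 0 < k) (V : Finset (Fin k → β)) :
    Sortable (2 * (k + Nat.log 2 V.card)) (V : Set (Fin k → β)) :=
  sortable_of_agreeBelow hk _ 0 V (Nat.zero_le _) (fun _ _ _ _ _ _ _ h => absurd h (by simp))
    (by simp)

end

/-! ### Tables encoding decision trees -/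

/-- The number of cells of a table that encodes a decision tree of depth `d`. -/
def tableSize (k : ℕ) : ℕ → ℕ
  | 0 => k
  | d + 1 => 2 * tableSize k d + 4

open Classical in
/-- Follow `d` steps of the decision tree in the table `M` from the node at address `p`. The cells
`p`, `p + 1` hold the indices to be compared, `p + 2` and `p + 3` the addresses of the children. -/
noncomputable def walk (R : ℕ → ℕ → Prop) (M : ℕ → ℕ) : ℕ → ℕ → ℕ
  | 0, p => p
  | d + 1, p => walk R M d (if R (M p) (M (p + 1)) then M (p + 2) else M (p + 3))

/-- The comparison of the entries of a word at given addresses; it fails outside the word. -/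
def WordLe {β : Type*} [LinearOrder β] {k : ℕ} (w : Fin k → β) (x y : ℕ) : Prop :=
  ∃ (hx : x < k) (hy : y < k), w ⟨x, hx⟩ ≤ w ⟨y, hy⟩

/-- The cells of `M` from `p` on list the positions of `w` in stable sorted order. -/
def Lists {β : Type*} [LinearOrder β] {k : ℕ} (M : ℕ → ℕ) (p : ℕ) (w : Fin k → β) : Prop :=
  ∃ σ : Fin k → Fin k, StableSorts w σ ∧ ∀ j : Fin k, M (p + j) = σ j

section

variable {β γ : Type*} [LinearOrder β] [LinearOrder γ] {k : ℕ}

theorem le_tableSize (k d : ℕ) : k ≤ tableSize k d := by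
  induction d with
  | zero => exact le_rfl
  | succ d ih =>
    rw [tableSize]
    omega

theorem tableSize_mono (k : ℕ) : Monotone (tableSize k) :=
  monotone_nat_of_le_succ fun d => by
    rw [tableSize]
    omega

/-- The root occupies four cells, followed by the tables of the two subtrees. Arbitrary offsets `o`
and arbitrary `M'` agreeing with `M` on the block allow a subtable to sit inside a larger table. The
bound on the entries makes them digits in base `tableSize k d` when `o = 0`. -/
theorem exists_table (hk : 0 < k) {d : ℕ} {V : Set (Fin k → β)} (h : Sortable d V) (o : ℕ) :
    ∃ M : ℕ → ℕ, (∀ x, M x < o + tableSize k d) ∧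
      ∀ M' : ℕ → ℕ, (∀ x, o ≤ x → x < o + tableSize k d → M' x = M x) →
        ∀ w ∈ V, Lists M' (walk (WordLe w) M' d o) w := by
  induction d generalizing V o with
  | zero =>
    obtain ⟨σ, hσ⟩ := h
    refine ⟨fun x => if hx : x - o < k then σ ⟨x - o, hx⟩ else 0, fun x => ?_,
      fun M' hM' w hw => ⟨σ, hσ w hw, fun j => ?_⟩⟩
    · dsimp only
      rw [tableSize]
      split_ifs with hx
      · have := (σ ⟨x - o, hx⟩).2
        omega
      · omega
    · rw [walk, hM' (o + j) (by omega) (by rw [tableSize]; omega)]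
      simp
  | succ d ih =>
    obtain ⟨a, b, h1, h2⟩ := h
    set z := tableSize k d with hz
    obtain ⟨M₁, hM₁, hw₁⟩ := ih h1 (o + 4)
    obtain ⟨M₂, hM₂, hw₂⟩ := ih h2 (o + 4 + z)
    have hkz : k ≤ z := le_tableSize k d
    have hsz : tableSize k (d + 1) = 2 * z + 4 := rfl
    refine ⟨fun x => if x ≤ o then a else if x = o + 1 then b else if x = o + 2 then o + 4 else
      if x = o + 3 then o + 4 + z else if x < o + 4 + z then M₁ x else M₂ x, fun x => ?_, ?_⟩
    · have := hM₁ x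
      have := hM₂ x
      have := a.2
      have := b.2
      dsimp only
      split_ifs <;> omega
    · intro M' hM' w hw
      have e0 : M' o = a := by rw [hM' o (by omega) (by omega)]; simp
      have e1 : M' (o + 1) = b := by rw [hM' _ (by omega) (by omega)]; simp
      have e2 : M' (o + 2) = o + 4 := by rw [hM' _ (by omega) (by omega)]; simp
      have e3 : M' (o + 3) = o + 4 + z := by rw [hM' _ (by omega) (by omega)]; simp
      have hiff : WordLe w a b ↔ w a ≤ w b := by simp [WordLe]
      rw [walk, e0, e1, e2, e3]
      by_cases hab : w a ≤ w b
      · rw [if_pos (hiff.2 hab)]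
        refine hw₁ M' (fun x hx hx' => ?_) w ⟨hw, hab⟩
        rw [hM' x (by omega) (by omega)]
        dsimp only
        rw [if_neg (by omega), if_neg (by omega), if_neg (by omega), if_neg (by omega),
          if_pos (by omega)]
      · rw [if_neg (hiff.not.2 hab)]
        refine hw₂ M' (fun x hx hx' => ?_) w ⟨hw, hab⟩
        rw [hM' x (by omega) (by omega)]
        dsimp only
        rw [if_neg (by omega), if_neg (by omega), if_neg (by omega), if_neg (by omega),
          if_neg (by omega)]

theorem wordLe_congr {w : Fin k → β} {v : Fin k → γ} (h : ∀ a b, w a ≤ w b ↔ v a ≤ v b) :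
    WordLe w = WordLe v := by
  funext x y
  simp [WordLe, h]

theorem Lists.congr {w : Fin k → β} {v : Fin k → γ} (h : ∀ a b, w a ≤ w b ↔ v a ≤ v b)
    {M : ℕ → ℕ} {p : ℕ} (hl : Lists M p w) : Lists M p v := by
  obtain ⟨σ, hσ, hM⟩ := hl
  refine ⟨σ, fun a b hab => ?_, hM⟩
  have := hσ a b hab
  simpa only [← not_le, le_antisymm_iff, h] using this

/-! ### Numbering the tables -/

/-- `M` is a table of `N` cells with entries less than `N`. -/
def IsTable (N : ℕ) (M : ℕ → ℕ) : Prop :=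
  (∀ i < N, M i < N) ∧ ∀ i, N ≤ i → M i = 0

/-- The number with base `N` digits `M 0, …, M (n - 1)`. -/
def digitSum (N : ℕ) (M : ℕ → ℕ) (n : ℕ) : ℕ :=
  ∑ i ∈ Finset.range n, M i * N ^ i

theorem digitSum_succ (N : ℕ) (M : ℕ → ℕ) (n : ℕ) :
    digitSum N M (n + 1) = digitSum N M n + M n * N ^ n :=
  Finset.sum_range_succ _ _

theorem digitSum_lt {N n : ℕ} {M : ℕ → ℕ} (h : ∀ i < n, M i < N) : digitSum N M n < N ^ n := by
  induction n with
  | zero => simp [digitSum]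
  | succ n ih =>
    rw [digitSum_succ, pow_succ]
    have h1 := ih fun i hi => h i (by omega)
    have h2 : M n + 1 ≤ N := h n (by omega)
    nlinarith [Nat.mul_le_mul_left (N ^ n) h2]

theorem eq_of_digitSum_eq {N n : ℕ} {M M' : ℕ → ℕ} (h : ∀ i < n, M i < N) (h' : ∀ i < n, M' i < N)
    (he : digitSum N M n = digitSum N M' n) : ∀ i < n, M i = M' i := by
  induction n with
  | zero => simp
  | succ n ih =>
    rw [digitSum_succ, digitSum_succ] at he
    have h1 := digitSum_lt (N := N) (M := M) fun i (hi : i < n) => h i (by omega)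
    have h2 := digitSum_lt (N := N) (M := M') fun i (hi : i < n) => h' i (by omega)
    have hn : M n = M' n := by
      have := congrArg (· / N ^ n) he
      simp only [Nat.add_mul_div_right _ _ (Nat.zero_lt_of_lt h1), Nat.div_eq_of_lt h1,
        Nat.div_eq_of_lt h2, zero_add] at this
      exact this
    intro i hi
    rcases Nat.lt_succ_iff_lt_or_eq.1 hi with hi | rfl
    · exact ih (fun i hi => h i (by omega)) (fun i hi => h' i (by omega)) (by rw [hn] at he; omega)
        i hi
    · exact hn

theorem digitSum_eq_zero {N n : ℕ} {M : ℕ → ℕ} (h : ∀ i < n, M i = 0) : digitSum N M n = 0 :=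
  Finset.sum_eq_zero fun i hi => by simp [h i (Finset.mem_range.1 hi)]

/-- This is the overflow case of the counter: the last table of one depth is followed by the first
table of the next. -/
theorem digitSum_of_full {N n : ℕ} {M : ℕ → ℕ} (h : ∀ i < n, M i + 1 = N) :
    digitSum N M n + 1 = N ^ n := by
  induction n with
  | zero => simp [digitSum]
  | succ n ih =>
    have h1 := ih fun i hi => h i (by omega)
    rw [digitSum_succ, pow_succ, ← h1]
    have h2 := h n (by omega)
    rw [add_right_comm, h1]
    have : N ^ n * N = N ^ n * (M n + 1) := by rw [h2]
    rw [this]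
    ring

theorem digitSum_carry {N i n : ℕ} {M M' : ℕ → ℕ} (hi : i < n) (h : ∀ j < i, M j + 1 = N)
    (h0 : ∀ j < i, M' j = 0) (h1 : M' i = M i + 1) (h2 : ∀ j, i < j → M' j = M j) :
    digitSum N M' n = digitSum N M n + 1 := by
  induction n, hi using Nat.le_induction with
  | base =>
    rw [digitSum_succ, digitSum_succ, digitSum_eq_zero h0, h1, ← Nat.succ_eq_add_one,
      Nat.succ_mul, ← digitSum_of_full h]
    ring
  | succ n hn ih =>
    rw [digitSum_succ, digitSum_succ, ih, h2 n (by omega)]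
    ring

/-- The number of tables for depths less than `d`. -/
def tableCount (k d : ℕ) : ℕ :=
  ∑ e ∈ Finset.range d, tableSize k e ^ tableSize k e

/-- The position of a table for depth `d` in the enumeration of all tables. -/
def tableRank (k d : ℕ) (M : ℕ → ℕ) : ℕ :=
  tableCount k d + digitSum (tableSize k d) M (tableSize k d)

theorem tableCount_succ (k d : ℕ) :
    tableCount k (d + 1) = tableCount k d + tableSize k d ^ tableSize k d :=
  Finset.sum_range_succ _ _

theorem tableCount_mono (k : ℕ) : Monotone (tableCount k) :=
  monotone_nat_of_le_succ fun d => by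
    rw [tableCount_succ]
    omega

theorem tableRank_lt {k d : ℕ} {M : ℕ → ℕ} (h : IsTable (tableSize k d) M) :
    tableRank k d M < tableCount k (d + 1) := by
  rw [tableCount_succ]
  exact Nat.add_lt_add_left (digitSum_lt h.1) _

/-- The ranks for depth `e` fill an interval ending before `tableCount k (e + 1)`. A bound on the
rank therefore bounds the depth, and with it the cost of each attempt. -/
theorem le_of_tableRank_le {k d e : ℕ} {M M' : ℕ → ℕ} (h' : IsTable (tableSize k e) M')
    (hr : tableRank k d M ≤ tableRank k e M') : d ≤ e := by
  by_contra! hlt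
  have h1 := tableRank_lt h'
  have h2 : tableCount k (e + 1) ≤ tableCount k d := tableCount_mono k hlt
  have h3 : tableCount k d ≤ tableRank k d M := Nat.le_add_right _ _
  omega

theorem eq_of_tableRank_eq {k d e : ℕ} {M M' : ℕ → ℕ} (h : IsTable (tableSize k d) M)
    (h' : IsTable (tableSize k e) M') (hr : tableRank k d M = tableRank k e M') :
    d = e ∧ ∀ i < tableSize k e, M i = M' i := by
  obtain rfl : d = e := le_antisymm (le_of_tableRank_le h' hr.le) (le_of_tableRank_le h hr.ge)
  exact ⟨rfl, eq_of_digitSum_eq h.1 h'.1 (Nat.add_left_cancel hr)⟩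

/-! ### Words and their ranks -/

/-- The number of entries of `s` less than its entry at position `i`. -/
def rankWord (s : Fin k → β) (i : Fin k) : Fin k :=
  ⟨(Finset.univ.filter fun j => s j < s i).card, by
    refine lt_of_lt_of_eq (Finset.card_lt_univ_of_notMem (x := i) (by simp)) (by simp)⟩

theorem val_rankWord (s : Fin k → β) (i : Fin k) :
    (rankWord s i).1 = (Finset.univ.filter fun j => s j < s i).card :=
  rfl

/-- Counting strictly smaller entries gives equal entries equal ranks, so all comparisons survive,
ties included. -/
theorem rankWord_le_iff (s : Fin k → β) (a b : Fin k) :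
    rankWord s a ≤ rankWord s b ↔ s a ≤ s b := by
  rw [Fin.le_def, val_rankWord, val_rankWord]
  constructor
  · intro h
    by_contra! hlt
    refine absurd h (not_le.2 (Finset.card_lt_card ?_))
    refine ⟨fun j hj => ?_, fun hc => ?_⟩
    · simp only [Finset.mem_filter, Finset.mem_univ, true_and] at hj ⊢
      exact hj.trans hlt
    · have : b ∈ Finset.univ.filter fun j => s j < s b := hc (by simpa using hlt)
      simp at this
  · intro h
    refine Finset.card_le_card fun j hj => ?_
    simp only [Finset.mem_filter, Finset.mem_univ, true_and] at hj ⊢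
    exact hj.trans_le h

theorem SeqAvoids.rankWord {l : ℕ} {π : Equiv.Perm (Fin l)} {s : Fin k → β}
    (h : SeqAvoids s π) : SeqAvoids (rankWord s) π := by
  rintro ⟨p, hp⟩
  refine h ⟨p, fun a b => ?_⟩
  rw [← hp, ← not_le, ← not_le, rankWord_le_iff]

end

/-! ### Reasoning about programs -/

/-- The program `P`, started in `s`, halts after some number `t` of steps in a state `s'` with
`Q t s'`. -/
def Runs {α : Type*} [LinearOrder α] (P : Prog) (s : State α) (Q : ℕ → State α → Prop) : Prop :=
  ∃ t s', Exec P s t s' ∧ Q t s'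

section

variable {α : Type*} [LinearOrder α] {P P' : Prog} {s : State α} {Q : ℕ → State α → Prop}

theorem Runs.mono {Q' : ℕ → State α → Prop} (h : Runs P s Q) (hQ : ∀ t s', Q t s' → Q' t s') :
    Runs P s Q' := by
  obtain ⟨t, s', he, hq⟩ := h
  exact ⟨t, s', he, hQ t s' hq⟩

theorem runs_skip : Runs .skip s Q ↔ Q 1 s :=
  ⟨by rintro ⟨_, _, h, hQ⟩; cases h; exact hQ, fun h => ⟨_, _, .skip s, h⟩⟩

theorem runs_zero {x : ℕ} : Runs (.zero x) s Q ↔ Q 1 (s.setReg x 0) :=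
  ⟨by rintro ⟨_, _, h, hQ⟩; cases h; exact hQ, fun h => ⟨_, _, .zero s x, h⟩⟩

theorem runs_copy {x y : ℕ} : Runs (.copy x y) s Q ↔ Q 1 (s.setReg x (s.reg y)) :=
  ⟨by rintro ⟨_, _, h, hQ⟩; cases h; exact hQ, fun h => ⟨_, _, .copy s x y, h⟩⟩

theorem runs_succ {x : ℕ} : Runs (.succ x) s Q ↔ Q 1 (s.setReg x (s.reg x + 1)) :=
  ⟨by rintro ⟨_, _, h, hQ⟩; cases h; exact hQ, fun h => ⟨_, _, .succ s x, h⟩⟩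

theorem runs_load {x a y : ℕ} : Runs (.load x a y) s Q ↔ Q 1 (s.setReg x (s.mem a (s.reg y))) :=
  ⟨by rintro ⟨_, _, h, hQ⟩; cases h; exact hQ, fun h => ⟨_, _, .load s x a y, h⟩⟩

theorem runs_store {a y x : ℕ} : Runs (.store a y x) s Q ↔ Q 1 (s.setMem a (s.reg y) (s.reg x)) :=
  ⟨by rintro ⟨_, _, h, hQ⟩; cases h; exact hQ, fun h => ⟨_, _, .store s a y x, h⟩⟩

theorem runs_move {a x b y : ℕ} :
    Runs (.move a x b y) s Q ↔ Q 1 (s.setElt a (s.reg x) (s.elt b (s.reg y))) :=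
  ⟨by rintro ⟨_, _, h, hQ⟩; cases h; exact hQ, fun h => ⟨_, _, .move s a x b y, h⟩⟩

theorem runs_seq :
    Runs (.seq P P') s Q ↔ Runs P s fun t s' => Runs P' s' fun t' s'' => Q (t + t') s'' := by
  constructor
  · rintro ⟨_, _, h, hQ⟩
    cases h with
    | seq h1 h2 => exact ⟨_, _, h1, _, _, h2, hQ⟩
  · rintro ⟨_, _, h1, _, _, h2, hQ⟩
    exact ⟨_, _, .seq h1 h2, hQ⟩

theorem runs_ite {b : Test} : Runs (.ite b P P') s Q ↔
    (b.Holds s → Runs P s fun t => Q (t + 1)) ∧ (¬ b.Holds s → Runs P' s fun t => Q (t + 1)) := by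
  constructor
  · rintro ⟨_, _, h, hQ⟩
    cases h with
    | ite_true hb h => exact ⟨fun _ => ⟨_, _, h, hQ⟩, fun hn => absurd hb hn⟩
    | ite_false hb h => exact ⟨fun hn => absurd hn hb, fun _ => ⟨_, _, h, hQ⟩⟩
  · rintro ⟨h1, h2⟩
    by_cases hb : b.Holds s
    · obtain ⟨_, _, h, hQ⟩ := h1 hb
      exact ⟨_, _, .ite_true hb h, hQ⟩
    · obtain ⟨_, _, h, hQ⟩ := h2 hb
      exact ⟨_, _, .ite_false hb h, hQ⟩

/-- A loop with invariant `I` whose iterations are paid for by the potential `Φ`. -/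
theorem runs_loop {b : Test} (I : State α → Prop) (Φ : State α → ℕ)
    (hstep : ∀ s, I s → b.Holds s → Runs P s fun t s' => I s' ∧ Φ s' + t + 1 ≤ Φ s) (hs : I s) :
    Runs (.loop b P) s fun t s' => I s' ∧ ¬ b.Holds s' ∧ t ≤ Φ s + 1 := by
  induction h : Φ s using Nat.strong_induction_on generalizing s with
  | _ n ih =>
    by_cases hb : b.Holds s
    · obtain ⟨t, s', he, hI, hΦ⟩ := hstep s hs hb
      obtain ⟨t', s'', he', hI', hb', ht'⟩ := ih (Φ s') (by omega) hI rfl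
      exact ⟨_, _, .loop_step hb he he', hI', hb', by omega⟩
    · exact ⟨_, _, .loop_done hb, hs, hb, by omega⟩

end

namespace State

variable {α : Type*} (s : State α)

theorem setReg_reg (x v y : ℕ) : (s.setReg x v).reg y = if y = x then v else s.reg y := by
  simp [setReg, Function.update_apply]

theorem setReg_mem (x v : ℕ) : (s.setReg x v).mem = s.mem := rfl

theorem setReg_elt (x v : ℕ) : (s.setReg x v).elt = s.elt := rfl

theorem setMem_reg (a i v : ℕ) : (s.setMem a i v).reg = s.reg := rfl

theorem setMem_elt (a i v : ℕ) : (s.setMem a i v).elt = s.elt := rfl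

theorem setMem_mem (a i v b j : ℕ) :
    (s.setMem a i v).mem b j = if b = a ∧ j = i then v else s.mem b j := by
  simp only [setMem, Function.update_apply]
  by_cases h : b = a
  · subst h
    simp [Function.update_apply]
  · simp [h]

theorem setElt_reg (a i : ℕ) (v : Option α) : (s.setElt a i v).reg = s.reg := rfl

theorem setElt_mem (a i : ℕ) (v : Option α) : (s.setElt a i v).mem = s.mem := rfl

theorem setElt_elt (a i : ℕ) (v : Option α) (b j : ℕ) :
    (s.setElt a i v).elt b j = if b = a ∧ j = i then v else s.elt b j := by
  simp only [setElt, Function.update_apply]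
  by_cases h : b = a
  · subst h
    simp [Function.update_apply]
  · simp [h]

end State

/-- The comparison of elements at given addresses of an element array; it fails at empty cells. -/
def EltLe {α : Type*} [LinearOrder α] (f : ℕ → Option α) (x y : ℕ) : Prop :=
  ∃ u v, f x = some u ∧ f y = some v ∧ u ≤ v

theorem holds_natLt {α : Type*} [LinearOrder α] {s : State α} {x y : ℕ} :
    (Test.natLt x y).Holds s ↔ s.reg x < s.reg y :=
  Iff.rfl

theorem holds_natEq {α : Type*} [LinearOrder α] {s : State α} {x y : ℕ} :
    (Test.natEq x y).Holds s ↔ s.reg x = s.reg y :=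
  Iff.rfl

theorem holds_elemLe {α : Type*} [LinearOrder α] {s : State α} {a x y : ℕ} :
    (Test.elemLe a x a y).Holds s ↔ EltLe (s.elt a) (s.reg x) (s.reg y) :=
  Iff.rfl

attribute [local simp] State.setReg_reg State.setReg_mem State.setReg_elt State.setMem_reg
  State.setMem_elt State.setMem_mem State.setElt_reg State.setElt_mem State.setElt_elt runs_skip
  runs_zero runs_copy runs_succ runs_load runs_store runs_move runs_seq runs_ite holds_natLt
  holds_natEq holds_elemLe

/-! ### The parts of the program

Registers: `0` holds `k`, `1` holds `m`, `2` the number of sequences sorted so far, `3` the address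
of the next sequence, `4` the depth of the current decision tree, `5` the size of its table, which
is stored in integer array `0`, and `20` holds zero. The sequence under consideration is copied to
element array `1`. -/

/-- Copy the current sequence to element array `1`. -/
def fetchProg : Prog :=
  .seq (.zero 7) <| .seq (.copy 8 3) <|
    .loop (.natLt 7 0) <| .seq (.move 1 7 0 8) <| .seq (.succ 7) (.succ 8)

/-- Follow the decision tree; register `9` is left with the address of a leaf. -/
def walkProg : Prog :=
  .seq (.zero 9) <| .seq (.zero 7) <|
    .loop (.natLt 7 4) <| .seq (.load 10 0 9) <| .seq (.succ 9) <| .seq (.load 11 0 9) <|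
      .seq (.succ 9) <| .seq (.ite (.elemLe 1 10 1 11) .skip (.succ 9)) <|
        .seq (.load 9 0 9) (.succ 7)

/-- Test whether the leaf lists the current sequence in stable sorted order; register `12` is left
with zero if it does. -/
def verifyProg : Prog :=
  .seq (.zero 12) <| .seq (.copy 8 9) <| .seq (.load 10 0 8) <|
    .seq (.ite (.elemLe 1 10 1 10) .skip (.succ 12)) <| .seq (.zero 7) <| .seq (.succ 7) <|
      .loop (.natLt 7 0) <| .seq (.succ 8) <| .seq (.load 11 0 8) <|
        .seq (.ite (.elemLe 1 10 1 11)
          (.ite (.elemLe 1 11 1 10) (.ite (.natLt 10 11) .skip (.succ 12)) .skip) (.succ 12)) <|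
          .seq (.copy 10 11) (.succ 7)

/-- Write the current sequence back in the order given by the leaf. -/
def outputProg : Prog :=
  .seq (.zero 7) <|
    .seq (.loop (.natLt 7 0) <| .seq (.load 10 0 9) <| .seq (.move 0 3 1 10) <|
      .seq (.succ 3) <| .seq (.succ 9) (.succ 7)) (.succ 2)

/-- Increment the number in integer array `0`; register `8` is left with zero unless it
overflows. -/
def incrementProg : Prog :=
  .seq (.zero 7) <| .seq (.copy 8 5) <|
    .loop (.natLt 7 8) <| .seq (.load 10 0 7) <| .seq (.succ 10) <|
      .ite (.natLt 10 5) (.seq (.store 0 7 10) (.zero 8)) (.seq (.store 0 7 20) (.succ 7))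

/-- Proceed to the tables for the next depth. -/
def growProg : Prog :=
  .seq (.succ 4) <| .seq (.zero 7) <| .seq (.copy 8 5) <|
    -- Register `8` starts at the old size and is raised by that size and then by four, following
    -- the recursion of `tableSize`.
    .seq (.loop (.natLt 7 5) <| .seq (.succ 7) (.succ 8)) <|
      .seq (.succ 8) <| .seq (.succ 8) <| .seq (.succ 8) <| .seq (.succ 8) (.copy 5 8)

/-! ### Specifications and running times of the parts -/

section

variable {α : Type*} [LinearOrder α]

theorem runs_fetchProg (s : State α) : Runs fetchProg s fun t s' =>
    t ≤ 4 * s.reg 0 + 3 ∧ (∀ x, x ≠ 7 → x ≠ 8 → s'.reg x = s.reg x) ∧ s'.mem = s.mem ∧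
      (∀ j, s'.elt 0 j = s.elt 0 j) ∧
      ∀ j, s'.elt 1 j = if j < s.reg 0 then s.elt 0 (s.reg 3 + j) else s.elt 1 j := by
  simp only [fetchProg, runs_seq, runs_zero, runs_copy]
  refine (runs_loop (fun s' => s'.reg 7 ≤ s.reg 0 ∧ s'.reg 8 = s.reg 3 + s'.reg 7 ∧
    (∀ x, x ≠ 7 → x ≠ 8 → s'.reg x = s.reg x) ∧ s'.mem = s.mem ∧
    (∀ j, s'.elt 0 j = s.elt 0 j) ∧
    ∀ j, s'.elt 1 j = if j < s'.reg 7 then s.elt 0 (s.reg 3 + j) else s.elt 1 j)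
    (fun s' => 4 * (s.reg 0 - s'.reg 7)) ?_ ?_).mono ?_
  · rintro s' ⟨h1, h2, h3, h4, h5, h6⟩ hb
    have hb' : s'.reg 7 < s.reg 0 := by simpa [h3] using hb
    simp only [runs_seq, runs_move, runs_succ]
    refine ⟨⟨by simp; omega, by simp; omega, fun x hx hx' => by simp [hx, hx', h3], by simp [h4],
      fun j => by simp [h5], fun j => ?_⟩, by simp; omega⟩
    simp only [State.setReg_elt, State.setElt_elt, State.setReg_reg, State.setElt_reg, true_and]
    rcases lt_trichotomy j (s'.reg 7) with hj | hj | hj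
    · simp [h6, hj, hj.ne, show j < s'.reg 7 + 1 by omega]
    · simp [hj, h5, h2]
    · simp [h6, hj.ne', show ¬ j < s'.reg 7 + 1 by omega, hj.not_gt]
  · simp +contextual
  · rintro t s' ⟨⟨h1, h2, h3, h4, h5, h6⟩, hb, ht⟩
    have hb' : ¬ s'.reg 7 < s.reg 0 := by simpa [h3] using hb
    have h7 : s'.reg 7 = s.reg 0 := by omega
    simp at ht
    exact ⟨by omega, h3, h4, h5, fun j => by rw [h6, h7]⟩

theorem runs_walkProg (s : State α) : Runs walkProg s fun t s' =>
    t ≤ 9 * s.reg 4 + 3 ∧ (∀ x, x ≠ 7 → x ≠ 9 → x ≠ 10 → x ≠ 11 → s'.reg x = s.reg x) ∧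
      s'.mem = s.mem ∧ s'.elt = s.elt ∧
      s'.reg 9 = walk (EltLe (s.elt 1)) (s.mem 0) (s.reg 4) 0 := by
  simp only [walkProg, runs_seq, runs_zero]
  -- The invariant says that the rest of the walk from the current node ends at the same leaf as the
  -- whole walk from the root.
  refine (runs_loop (fun s' => s'.reg 7 ≤ s.reg 4 ∧
    (∀ x, x ≠ 7 → x ≠ 9 → x ≠ 10 → x ≠ 11 → s'.reg x = s.reg x) ∧
      s'.mem = s.mem ∧ s'.elt = s.elt ∧
      walk (EltLe (s.elt 1)) (s.mem 0) (s.reg 4 - s'.reg 7) (s'.reg 9) =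
        walk (EltLe (s.elt 1)) (s.mem 0) (s.reg 4) 0)
    (fun s' => 9 * (s.reg 4 - s'.reg 7)) ?_ ?_).mono ?_
  · rintro s' ⟨h1, h2, h3, h4, h5⟩ hb
    have hb' : s'.reg 7 < s.reg 4 := by simpa [h2] using hb
    obtain ⟨e, he⟩ : ∃ e, s.reg 4 - s'.reg 7 = e + 1 := ⟨s.reg 4 - s'.reg 7 - 1, by omega⟩
    have he' : s.reg 4 - (s'.reg 7 + 1) = e := by omega
    rw [he, walk] at h5
    by_cases hle : EltLe (s.elt 1) (s.mem 0 (s'.reg 9)) (s.mem 0 (s'.reg 9 + 1))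
    · rw [if_pos hle] at h5
      simp [h3, h4, hle, he', h5]
      refine ⟨⟨by omega, fun x h7 h9 h10 h11 => by simp [h7, h9, h10, h11, h2]⟩, by omega⟩
    · rw [if_neg hle] at h5
      simp [h3, h4, hle, he', h5]
      refine ⟨⟨by omega, fun x h7 h9 h10 h11 => by simp [h7, h9, h10, h11, h2]⟩, by omega⟩
  · simp +contextual
  · rintro t s' ⟨⟨h1, h2, h3, h4, h5⟩, hb, ht⟩
    have hb' : ¬ s'.reg 7 < s.reg 4 := by simpa [h2] using hb
    simp at ht
    rw [show s.reg 4 - s'.reg 7 = 0 by omega, walk] at h5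
    exact ⟨by omega, h2, h3, h4, h5⟩

end

section

variable {α : Type*} [LinearOrder α]

/-- The address `x` precedes `y` in the stable order of the elements of an array. -/
def EltStableLT (f : ℕ → Option α) (x y : ℕ) : Prop :=
  EltLe f x y ∧ (EltLe f y x → x < y)

theorem runs_verifyProg (s : State α) : Runs verifyProg s fun t s' =>
    t ≤ 9 * s.reg 0 + 8 ∧
      (∀ x, x ≠ 7 → x ≠ 8 → x ≠ 10 → x ≠ 11 → x ≠ 12 → s'.reg x = s.reg x) ∧
      s'.mem = s.mem ∧ s'.elt = s.elt ∧
      (s'.reg 12 = 0 ↔ EltLe (s.elt 1) (s.mem 0 (s.reg 9)) (s.mem 0 (s.reg 9)) ∧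
        ∀ i, i + 1 < s.reg 0 →
          EltStableLT (s.elt 1) (s.mem 0 (s.reg 9 + i)) (s.mem 0 (s.reg 9 + i + 1))) := by
  -- The counter starts at `1`; the alternative `s'.reg 7 = 1` covers the case `s.reg 0 = 0`, in
  -- which it already exceeds its bound.
  let I : State α → Prop := fun s' => 1 ≤ s'.reg 7 ∧ (s'.reg 7 ≤ s.reg 0 ∨ s'.reg 7 = 1) ∧
    s'.reg 8 + 1 = s.reg 9 + s'.reg 7 ∧ s'.reg 10 = s.mem 0 (s'.reg 8) ∧
    (∀ x, x ≠ 7 → x ≠ 8 → x ≠ 10 → x ≠ 11 → x ≠ 12 → s'.reg x = s.reg x) ∧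
      s'.mem = s.mem ∧ s'.elt = s.elt ∧
      (s'.reg 12 = 0 ↔ EltLe (s.elt 1) (s.mem 0 (s.reg 9)) (s.mem 0 (s.reg 9)) ∧
        ∀ i, i + 1 < s'.reg 7 →
          EltStableLT (s.elt 1) (s.mem 0 (s.reg 9 + i)) (s.mem 0 (s.reg 9 + i + 1)))
  let loopProg : Prog := .loop (.natLt 7 0) <| .seq (.succ 8) <| .seq (.load 11 0 8) <|
        .seq (.ite (.elemLe 1 10 1 11)
          (.ite (.elemLe 1 11 1 10) (.ite (.natLt 10 11) .skip (.succ 12)) .skip) (.succ 12)) <|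
          .seq (.copy 10 11) (.succ 7)
  have hloop : ∀ s₁, I s₁ → Runs loopProg s₁ fun t s' => I s' ∧ ¬ (Test.natLt 7 0).Holds s' ∧
      t ≤ 9 * (s.reg 0 - s₁.reg 7) + 1 := by
    intro s₁ hs₁
    refine runs_loop I (fun s' => 9 * (s.reg 0 - s'.reg 7)) ?_ hs₁
    rintro s' ⟨h0, h1, h2, h3, h4, h5, h6, h7⟩ hb
    have hb' : s'.reg 7 < s.reg 0 := by simpa [h4] using hb
    obtain ⟨j, hj⟩ : ∃ j, s'.reg 7 = j + 1 := ⟨s'.reg 7 - 1, by omega⟩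
    have h8 : s'.reg 8 = s.reg 9 + j := by omega
    have hall : ∀ p : ℕ → Prop, (∀ i, i + 1 < j + 1 + 1 → p i) ↔
        (∀ i, i + 1 < j + 1 → p i) ∧ p j := fun p => by
      refine ⟨fun h => ⟨fun i hi => h i (by omega), h j (by omega)⟩, fun h i hi => ?_⟩
      rcases Nat.lt_or_ge i j with hij | hij
      · exact h.1 i (by omega)
      · obtain rfl : i = j := by omega
        exact h.2
    rw [hj] at h7
    have hfin : ∀ v : ℕ, (v = 0 ↔ (EltLe (s.elt 1) (s.mem 0 (s.reg 9)) (s.mem 0 (s.reg 9)) ∧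
        ∀ i, i + 1 < j + 1 →
          EltStableLT (s.elt 1) (s.mem 0 (s.reg 9 + i)) (s.mem 0 (s.reg 9 + i + 1))) ∧
        EltStableLT (s.elt 1) (s.mem 0 (s.reg 9 + j)) (s.mem 0 (s.reg 9 + j + 1))) →
        ∀ s'' : State α, s''.mem = s'.mem → s''.elt = s'.elt → s''.reg 7 = s'.reg 7 + 1 →
        s''.reg 8 = s'.reg 8 + 1 → s''.reg 10 = s.mem 0 (s.reg 9 + j + 1) → s''.reg 12 = v →
        (∀ x, x ≠ 7 → x ≠ 8 → x ≠ 10 → x ≠ 11 → x ≠ 12 → s''.reg x = s'.reg x) → I s'' := by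
      intro v hv s'' e1 e2 e3 e4 e5 e6 e7
      refine ⟨by omega, by omega, by omega, by rw [e5, e4, h8], fun x a b c d e => ?_,
        by rw [e1, h5], by rw [e2, h6], ?_⟩
      · rw [e7 x a b c d e, h4 x a b c d e]
      · rw [e6, hv, e3, hj, hall, and_assoc]
    by_cases c1 : EltLe (s.elt 1) (s.mem 0 (s.reg 9 + j)) (s.mem 0 (s.reg 9 + j + 1))
    · by_cases c2 : EltLe (s.elt 1) (s.mem 0 (s.reg 9 + j + 1)) (s.mem 0 (s.reg 9 + j))
      · by_cases c3 : s.mem 0 (s.reg 9 + j) < s.mem 0 (s.reg 9 + j + 1)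
        · simp only [runs_seq, runs_succ, runs_load, runs_ite, runs_copy, runs_skip]
          simp [h3, h5, h6, h8, c1, c2, c3]
          refine ⟨hfin (s'.reg 12) ?_ _ (by simp) (by simp) (by simp) (by simp [h8]) (by simp)
            (by simp) (by simp +contextual), by omega⟩
          rw [h7]
          exact ⟨fun h => ⟨h, c1, fun _ => c3⟩, fun h => h.1⟩
        · simp only [runs_seq, runs_succ, runs_load, runs_ite, runs_copy, runs_skip]
          simp [h3, h5, h6, h8, c1, c2, c3]
          refine ⟨hfin (s'.reg 12 + 1) ?_ _ (by simp) (by simp) (by simp) (by simp [h8]) (by simp)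
            (by simp) (by simp +contextual), by omega⟩
          exact ⟨fun h => absurd h (by omega), fun h => absurd (h.2.2 c2) c3⟩
      · simp only [runs_seq, runs_succ, runs_load, runs_ite, runs_copy, runs_skip]
        simp [h3, h5, h6, h8, c1, c2]
        refine ⟨hfin (s'.reg 12) ?_ _ (by simp) (by simp) (by simp) (by simp [h8]) (by simp)
            (by simp) (by simp +contextual), by omega⟩
        rw [h7]
        exact ⟨fun h => ⟨h, c1, fun h => absurd h c2⟩, fun h => h.1⟩
    · simp only [runs_seq, runs_succ, runs_load, runs_ite, runs_copy, runs_skip]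
      simp [h3, h5, h6, h8, c1]
      refine ⟨hfin (s'.reg 12 + 1) ?_ _ (by simp) (by simp) (by simp) (by simp [h8]) (by simp)
            (by simp) (by simp +contextual), by omega⟩
      exact ⟨fun h => absurd h (by omega), fun h => absurd h.2.1 c1⟩
  have hpost : ∀ (t₀ : ℕ) (s₁ : State α), t₀ ≤ 7 → s₁.reg 7 = 1 → I s₁ →
      Runs loopProg s₁ fun t s' => t₀ + t ≤ 9 * s.reg 0 + 8 ∧
      (∀ x, x ≠ 7 → x ≠ 8 → x ≠ 10 → x ≠ 11 → x ≠ 12 → s'.reg x = s.reg x) ∧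
      s'.mem = s.mem ∧ s'.elt = s.elt ∧
      (s'.reg 12 = 0 ↔ EltLe (s.elt 1) (s.mem 0 (s.reg 9)) (s.mem 0 (s.reg 9)) ∧
        ∀ i, i + 1 < s.reg 0 →
          EltStableLT (s.elt 1) (s.mem 0 (s.reg 9 + i)) (s.mem 0 (s.reg 9 + i + 1))) := by
    intro t₀ s₁ ht₀ h71 hI
    refine (hloop s₁ hI).mono ?_
    rintro t s' ⟨⟨h0, h1, h2, h3, h4, h5, h6, h7⟩, hb, ht⟩
    have hb' : ¬ s'.reg 7 < s.reg 0 := by simpa [h4] using hb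
    refine ⟨by omega, h4, h5, h6, h7.trans (and_congr_right fun _ => forall_congr' fun i => ?_)⟩
    refine imp_congr_left ?_
    omega
  simp only [verifyProg, runs_seq, runs_zero, runs_copy, runs_load, runs_succ, runs_ite, runs_skip]
  refine ⟨fun hb => ?_, fun hb => ?_⟩
  · have hb' : EltLe (s.elt 1) (s.mem 0 (s.reg 9)) (s.mem 0 (s.reg 9)) := by simpa using hb
    refine (hpost 7 _ le_rfl (by simp) ?_).mono fun t s' h => ⟨?_, h.2⟩
    · refine ⟨by simp, by simp, by simp, by simp, by simp +contextual, by simp, by simp, ?_⟩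
      simp [hb']
    · have := h.1
      omega
  · have hb' : ¬ EltLe (s.elt 1) (s.mem 0 (s.reg 9)) (s.mem 0 (s.reg 9)) := by simpa using hb
    refine (hpost 7 _ le_rfl (by simp) ?_).mono fun t s' h => ⟨?_, h.2⟩
    · refine ⟨by simp, by simp, by simp, by simp, by simp +contextual, by simp, by simp, ?_⟩
      simp [hb']
    · have := h.1
      omega

theorem runs_outputProg (s : State α) : Runs outputProg s fun t s' =>
    t ≤ 6 * s.reg 0 + 3 ∧
      (∀ x, x ≠ 2 → x ≠ 3 → x ≠ 7 → x ≠ 9 → x ≠ 10 → s'.reg x = s.reg x) ∧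
      s'.reg 2 = s.reg 2 + 1 ∧ s'.reg 3 = s.reg 3 + s.reg 0 ∧ s'.mem = s.mem ∧
      (∀ j, s'.elt 1 j = s.elt 1 j) ∧
      ∀ j, s'.elt 0 j = if s.reg 3 ≤ j ∧ j < s.reg 3 + s.reg 0 then
        s.elt 1 (s.mem 0 (s.reg 9 + (j - s.reg 3))) else s.elt 0 j := by
  simp only [outputProg, runs_seq, runs_zero]
  refine (runs_loop (fun s' => s'.reg 7 ≤ s.reg 0 ∧
      (∀ x, x ≠ 3 → x ≠ 7 → x ≠ 9 → x ≠ 10 → s'.reg x = s.reg x) ∧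
      s'.reg 3 = s.reg 3 + s'.reg 7 ∧ s'.reg 9 = s.reg 9 + s'.reg 7 ∧ s'.mem = s.mem ∧
      (∀ j, s'.elt 1 j = s.elt 1 j) ∧
      ∀ j, s'.elt 0 j = if s.reg 3 ≤ j ∧ j < s.reg 3 + s'.reg 7 then
        s.elt 1 (s.mem 0 (s.reg 9 + (j - s.reg 3))) else s.elt 0 j)
    (fun s' => 6 * (s.reg 0 - s'.reg 7)) ?_ ?_).mono ?_
  · rintro s' ⟨h1, h2, h3, h4, h5, h6, h7⟩ hb
    have hb' : s'.reg 7 < s.reg 0 := by simpa [h2] using hb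
    simp only [runs_seq, runs_move, runs_succ, runs_load]
    refine ⟨⟨by simp; omega, fun x a b c d => by simp [a, b, c, d, h2], by simp [h3]; omega,
      by simp [h4]; omega, by simp [h5], fun j => by simp [h6], fun j => ?_⟩, by simp; omega⟩
    simp [h3, h4, h5, h6, h7]
    by_cases hj : j = s.reg 3 + s'.reg 7
    · rw [if_pos hj, if_pos ⟨by omega, by omega⟩, hj]
      congr 3
      omega
    · rw [if_neg hj]
      refine if_congr ?_ rfl rfl
      omega
  · refine ⟨by simp, by simp +contextual, by simp, by simp, by simp, by simp, fun j => ?_⟩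
    rw [if_neg (by simp)]
    simp
  · rintro t s' ⟨⟨h1, h2, h3, h4, h5, h6, h7⟩, hb, ht⟩
    have hb' : ¬ s'.reg 7 < s.reg 0 := by simpa [h2] using hb
    have e7 : s'.reg 7 = s.reg 0 := by omega
    simp only [State.setReg_reg, if_true] at ht
    rw [runs_succ]
    refine ⟨by omega, fun x a b c d e => by simp [a, b, c, d, e, h2], by simp [h2],
      by simp [h3, e7], by simp [h5], fun j => by simp [h6], fun j => ?_⟩
    simp [h7, e7]

theorem runs_incrementProg (s : State α) (h20 : s.reg 20 = 0)
    (hM : ∀ i < s.reg 5, s.mem 0 i < s.reg 5) : Runs incrementProg s fun t s' =>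
    t ≤ 6 * s.reg 5 + 3 ∧ (∀ x, x ≠ 7 → x ≠ 8 → x ≠ 10 → s'.reg x = s.reg x) ∧
      s'.elt = s.elt ∧
      ((s'.reg 8 = s.reg 5 ∧ (∀ j < s.reg 5, s'.mem 0 j = 0) ∧
          (∀ j < s.reg 5, s.mem 0 j + 1 = s.reg 5) ∧ ∀ j, s.reg 5 ≤ j → s'.mem 0 j = s.mem 0 j) ∨
        (s'.reg 8 = 0 ∧ ∃ i < s.reg 5, (∀ j < i, s.mem 0 j + 1 = s.reg 5) ∧
          (∀ j < i, s'.mem 0 j = 0) ∧ s'.mem 0 i = s.mem 0 i + 1 ∧ s.mem 0 i + 1 < s.reg 5 ∧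
          ∀ j, i < j → s'.mem 0 j = s.mem 0 j)) := by
  simp only [incrementProg, runs_seq, runs_zero, runs_copy]
  refine (runs_loop (fun s' => (∀ x, x ≠ 7 → x ≠ 8 → x ≠ 10 → s'.reg x = s.reg x) ∧
      s'.elt = s.elt ∧
      ((s'.reg 8 = s.reg 5 ∧ s'.reg 7 ≤ s.reg 5 ∧ (∀ j < s'.reg 7, s'.mem 0 j = 0) ∧
          (∀ j < s'.reg 7, s.mem 0 j + 1 = s.reg 5) ∧ ∀ j, s'.reg 7 ≤ j → s'.mem 0 j = s.mem 0 j) ∨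
        (s'.reg 8 = 0 ∧ ∃ i < s.reg 5, (∀ j < i, s.mem 0 j + 1 = s.reg 5) ∧
          (∀ j < i, s'.mem 0 j = 0) ∧ s'.mem 0 i = s.mem 0 i + 1 ∧ s.mem 0 i + 1 < s.reg 5 ∧
          ∀ j, i < j → s'.mem 0 j = s.mem 0 j)))
    -- Once a digit is incremented without a carry, register `8` is cleared, so the truncated
    -- difference vanishes and the loop stops.
    (fun s' => 6 * (s'.reg 8 - s'.reg 7)) ?_ ?_).mono ?_
  · rintro s' ⟨h1, h2, h⟩ hb
    have hb' : s'.reg 7 < s'.reg 8 := by simpa using hb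
    rcases h with ⟨h8, h7, h3, h4, h5⟩ | ⟨h8, -⟩
    swap
    · omega
    have e5 : s'.reg 5 = s.reg 5 := h1 5 (by simp) (by simp) (by simp)
    have e20 : s'.reg 20 = 0 := (h1 20 (by simp) (by simp) (by simp)).trans h20
    simp only [runs_seq, runs_load, runs_succ, runs_ite, runs_store, runs_zero]
    refine ⟨fun hc => ⟨⟨fun x a b c => by simp [a, b, c, h1], by simp [h2], Or.inr ⟨by simp,
      s'.reg 7, by omega, h4, fun j hj => ?_, ?_, ?_, fun j hj => ?_⟩⟩, ?_⟩,
      fun hc => ⟨⟨fun x a b c => by simp [a, b, c, h1], by simp [h2], Or.inl ⟨by simp [h8],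
      by simp; omega, fun j hj => ?_, fun j hj => ?_, fun j hj => ?_⟩⟩, ?_⟩⟩
    · simp [h3 j hj, hj.ne]
    · simp [h5]
    · simpa [h5, e5] using hc
    · simp [hj.ne', h5 j hj.le]
    · simp
      omega
    · simp only [State.setReg_reg, State.setReg_mem, State.setMem_reg, State.setMem_mem] at hj ⊢
      simp [e20] at hj ⊢
      intro hne
      exact h3 j (by omega)
    · simp at hj
      rcases Nat.lt_succ_iff_lt_or_eq.1 (Nat.lt_succ_of_le hj) with hj' | rfl
      · exact h4 j hj'
      · have hc' : ¬ s.mem 0 (s'.reg 7) + 1 < s.reg 5 := by simpa [h5, e5] using hc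
        have := hM (s'.reg 7) (by omega)
        omega
    · simp at hj
      simp [show j ≠ s'.reg 7 by omega, h5 j (by omega)]
    · simp
      omega
  · refine ⟨by simp +contextual, by simp, Or.inl ⟨by simp, by simp, by simp, by simp, by simp⟩⟩
  · rintro t s' ⟨⟨h1, h2, h⟩, hb, ht⟩
    have hb' : ¬ s'.reg 7 < s'.reg 8 := by simpa using hb
    simp at ht
    refine ⟨by omega, h1, h2, ?_⟩
    rcases h with ⟨h8, h7, h3, h4, h5⟩ | h
    · have e7 : s'.reg 7 = s.reg 5 := by omega
      rw [e7] at h3 h4 h5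
      exact Or.inl ⟨h8, h3, h4, h5⟩
    · exact Or.inr h

theorem runs_growProg (s : State α) : Runs growProg s fun t s' =>
    t ≤ 3 * s.reg 5 + 9 ∧ (∀ x, x ≠ 4 → x ≠ 5 → x ≠ 7 → x ≠ 8 → s'.reg x = s.reg x) ∧
      s'.reg 4 = s.reg 4 + 1 ∧ s'.reg 5 = 2 * s.reg 5 + 4 ∧ s'.mem = s.mem ∧ s'.elt = s.elt := by
  simp only [growProg, runs_seq, runs_zero, runs_copy, runs_succ]
  refine (runs_loop (fun s' => s'.reg 7 ≤ s.reg 5 ∧ s'.reg 8 = s.reg 5 + s'.reg 7 ∧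
      s'.reg 4 = s.reg 4 + 1 ∧ (∀ x, x ≠ 4 → x ≠ 7 → x ≠ 8 → s'.reg x = s.reg x) ∧
      s'.mem = s.mem ∧ s'.elt = s.elt)
    (fun s' => 3 * (s.reg 5 - s'.reg 7)) ?_ ?_).mono ?_
  · rintro s' ⟨h1, h2, h3, h4, h5, h6⟩ hb
    have hb' : s'.reg 7 < s.reg 5 := by simpa [h4] using hb
    simp only [runs_seq, runs_succ]
    refine ⟨⟨by simp; omega, by simp; omega, by simp [h3], fun x a b c => by simp [a, b, c, h4],
      by simp [h5], by simp [h6]⟩, by simp; omega⟩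
  · simp +contextual
  · rintro t s' ⟨⟨h1, h2, h3, h4, h5, h6⟩, hb, ht⟩
    have hb' : ¬ s'.reg 7 < s.reg 5 := by simpa [h4] using hb
    simp at ht
    exact ⟨by omega, fun x a b c d => by simp [a, b, c, d, h4], by simp [h3],
      by simp [h2]; omega, by simp [h5], by simp [h6]⟩

end

/-! ### Correctness and running time of the whole program -/

/-- Proceed to the next table. -/
def advanceProg : Prog :=
  .seq incrementProg (.ite (.natLt 20 8) growProg .skip)

/-- Try to sort the current sequence with the current table. If this fails, proceed to the next
table. -/
def attemptProg : Prog :=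
  .seq fetchProg <| .seq walkProg <| .seq verifyProg <| .ite (.natEq 12 20) outputProg advanceProg

/-- Sort the sequences one after the other, trying the tables in order of their depth. -/
def sortProg : Prog :=
  -- A table for depth `0` has `k` cells, and the initial all-zero array is the table of rank `0`.
  .seq (.copy 5 0) (.loop (.natLt 2 1) attemptProg)

section

variable {α : Type*} [LinearOrder α] {k : ℕ}

theorem StableLT.trans {w : Fin k → α} {a b c : Fin k} (h : StableLT w a b)
    (h' : StableLT w b c) : StableLT w a c := by
  rcases h with h | ⟨h, hl⟩ <;> rcases h' with h' | ⟨h', hl'⟩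
  · exact Or.inl (h.trans h')
  · exact Or.inl (h' ▸ h)
  · exact Or.inl (h ▸ h')
  · exact Or.inr ⟨h.trans h', hl.trans hl'⟩

/-- The element array `f` holds exactly the word `w`. -/
def Holds (f : ℕ → Option α) (w : Fin k → α) : Prop :=
  ∀ j, f j = if h : j < k then some (w ⟨j, h⟩) else none

theorem Holds.eltLe {f : ℕ → Option α} {w : Fin k → α} (h : Holds f w) : EltLe f = WordLe w := by
  funext x y
  by_cases hx : x < k <;> by_cases hy : y < k <;> simp [EltLe, WordLe, h x, h y, hx, hy]

theorem wordLe_and_iff_stableLT {w : Fin k → α} {x y : ℕ} :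
    WordLe w x y ∧ (WordLe w y x → x < y) ↔
      ∃ (hx : x < k) (hy : y < k), StableLT w ⟨x, hx⟩ ⟨y, hy⟩ := by
  by_cases hx : x < k <;> by_cases hy : y < k <;> simp [WordLe, StableLT, hx, hy]
  rcases lt_trichotomy (w ⟨x, hx⟩) (w ⟨y, hy⟩) with h | h | h
  · simp [h, h.le, h.not_ge]
  · simp [h]
  · simp [h.not_ge, h.not_gt, h.ne']

/-- Cells outside the word are empty and comparisons with them fail, so the self-comparison checks
that the first address is valid and each later comparison checks the next one. Transitivity extends
the stable order from consecutive addresses to all pairs, so linear time suffices for verification.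
-/
theorem Holds.chain_iff_lists {f : ℕ → Option α} {w : Fin k → α} (h : Holds f w) (hk : 0 < k)
    {M : ℕ → ℕ} {p : ℕ} :
    (EltLe f (M p) (M p) ∧ ∀ i, i + 1 < k → EltStableLT f (M (p + i)) (M (p + i + 1))) ↔
      Lists M p w := by
  simp only [EltStableLT, h.eltLe, wordLe_and_iff_stableLT]
  constructor
  · rintro ⟨⟨h0, -, -⟩, hs⟩
    have hlt : ∀ j, j < k → M (p + j) < k := by
      intro j hj
      rcases j with _ | j
      · exact h0
      · exact (hs j hj).2.1
    have hchain : ∀ n (hn : n < k) i (hi : i < n),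
        StableLT w ⟨M (p + i), hlt i (hi.trans hn)⟩ ⟨M (p + n), hlt n hn⟩ := by
      intro n
      induction n with
      | zero => intro _ i hi; omega
      | succ n ih =>
        intro hn i hi
        obtain ⟨_, _, hstep⟩ := hs n hn
        rcases Nat.lt_succ_iff_lt_or_eq.1 hi with hi | rfl
        · exact (ih (by omega) i hi).trans hstep
        · exact hstep
    exact ⟨fun j => ⟨M (p + j), hlt j j.2⟩, fun a b hab => hchain b b.2 a hab, fun j => rfl⟩
  · rintro ⟨σ, hσ, hM⟩
    have e0 : M p = σ ⟨0, hk⟩ := hM ⟨0, hk⟩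
    refine ⟨⟨by rw [e0]; exact (σ _).2, by rw [e0]; exact (σ _).2, le_rfl⟩, fun i hi => ?_⟩
    have e1 : M (p + i) = σ ⟨i, by omega⟩ := hM ⟨i, by omega⟩
    have e2 : M (p + i + 1) = σ ⟨i + 1, hi⟩ := hM ⟨i + 1, hi⟩
    simp only [e1, e2]
    exact ⟨(σ _).2, (σ _).2, hσ _ _ (by simp [Fin.lt_def])⟩

theorem Lists.exists_perm {M : ℕ → ℕ} {p : ℕ} {w : Fin k → α} (h : Lists M p w) :
    ∃ σ : Equiv.Perm (Fin k), Monotone (w ∘ σ) ∧ ∀ j : Fin k, M (p + j) = σ j := by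
  obtain ⟨σ, hσ, hM⟩ := h
  have hinj : Function.Injective σ := by
    intro a b hab
    by_contra hne
    rcases lt_or_gt_of_ne hne with hlt | hlt
    · have := hσ a b hlt
      simp [hab] at this
    · have := hσ b a hlt
      simp [hab] at this
  refine ⟨Equiv.ofBijective σ (Finite.injective_iff_bijective.1 hinj), fun a b hab => ?_, hM⟩
  rcases hab.eq_or_lt with rfl | hlt
  · exact le_rfl
  · exact StableLT.le (w := w) (a := σ a) (b := σ b) (hσ a b hlt)

/-- Without overflow this is a carry in base `tableSize k d`. With overflow the digits have become
zero, which is the first table for the next depth. The rank grows by exactly one in both cases. -/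
theorem runs_advanceProg (hk : 0 < k) (s : State α) (h20 : s.reg 20 = 0)
    (h5 : s.reg 5 = tableSize k (s.reg 4)) (hM : IsTable (s.reg 5) (s.mem 0)) :
    Runs advanceProg s fun t s' => t ≤ 9 * s.reg 5 + 14 ∧
      (∀ x, x ≠ 4 → x ≠ 5 → x ≠ 7 → x ≠ 8 → x ≠ 10 → s'.reg x = s.reg x) ∧ s'.elt = s.elt ∧
      s'.reg 5 = tableSize k (s'.reg 4) ∧ IsTable (s'.reg 5) (s'.mem 0) ∧
      tableRank k (s'.reg 4) (s'.mem 0) = tableRank k (s.reg 4) (s.mem 0) + 1 := by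
  rw [advanceProg, runs_seq]
  refine (runs_incrementProg s h20 hM.1).mono ?_
  rintro t s₁ ⟨ht, hr, he, h⟩
  have e4 : s₁.reg 4 = s.reg 4 := hr 4 (by simp) (by simp) (by simp)
  have e5 : s₁.reg 5 = s.reg 5 := hr 5 (by simp) (by simp) (by simp)
  have e20 : s₁.reg 20 = 0 := (hr 20 (by simp) (by simp) (by simp)).trans h20
  have hN : 0 < s.reg 5 := h5 ▸ hk.trans_le (le_tableSize k _)
  rw [runs_ite]
  rcases h with ⟨h8, h0, hfull, hrest⟩ | ⟨h8, i, hi, hfull, h0, h1, h1', h2⟩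
  · refine ⟨fun _ => ?_, fun hb => absurd (show s₁.reg 20 < s₁.reg 8 by omega) hb⟩
    refine (runs_growProg s₁).mono ?_
    rintro t' s' ⟨ht', hr', g4, g5, hm, he'⟩
    have hz : ∀ j, s'.mem 0 j = 0 := fun j => by
      rw [hm]
      rcases Nat.lt_or_ge j (s.reg 5) with hj | hj
      · exact h0 j hj
      · rw [hrest j hj, hM.2 j hj]
    refine ⟨by omega, fun x a b c d e => (hr' x a b c d).trans (hr x c d e), he'.trans he,
      ?_, ?_, ?_⟩
    · rw [g4, g5, e4, e5, h5, tableSize]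
    · exact ⟨fun j _ => by rw [hz]; omega, fun j _ => hz j⟩
    · rw [g4, e4, tableRank, tableRank, tableCount_succ, digitSum_eq_zero fun j _ => hz j]
      rw [h5] at hfull
      rw [add_assoc _ _ 1, digitSum_of_full hfull, add_zero]
  · refine ⟨fun hb => absurd (show s₁.reg 20 < s₁.reg 8 from hb) (by omega), fun _ => ?_⟩
    rw [runs_skip]
    refine ⟨by omega, fun x a b c d e => hr x c d e, he, by rw [e4, e5, h5], ⟨fun j hj => ?_,
      fun j hj => ?_⟩, ?_⟩
    · rw [e5] at hj ⊢
      rcases lt_trichotomy j i with hji | rfl | hji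
      · rw [h0 j hji]
        exact hN
      · rw [h1]
        exact h1'
      · rw [h2 j hji]
        exact hM.1 j hj
    · rw [e5] at hj
      rw [h2 j (by omega), hM.2 j hj]
    · rw [e4, tableRank, tableRank, add_assoc, ← h5, digitSum_carry hi hfull h0 h1 h2]

/-- The state of the sorting program when the first sequences are already sorted. -/
structure Progress {m : ℕ} (S : Fin m → Fin k → α) (s : State α) : Prop where
  reg_zero : s.reg 0 = k
  reg_one : s.reg 1 = m
  reg_two : s.reg 2 ≤ m
  reg_three : s.reg 3 = s.reg 2 * k
  reg_five : s.reg 5 = tableSize k (s.reg 4)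
  reg_twenty : s.reg 20 = 0
  table : IsTable (s.reg 5) (s.mem 0)
  -- This makes out-of-range addresses in a meaningless table detectable by a failing comparison.
  empty : ∀ j, k ≤ j → s.elt 1 j = none
  sorted : ∀ i : Fin m, i.1 < s.reg 2 → ∃ σ : Equiv.Perm (Fin k), Monotone (S i ∘ σ) ∧
    ∀ j : Fin k, s.elt 0 (i * k + j) = some (S i (σ j))
  unsorted : ∀ i : Fin m, s.reg 2 ≤ i.1 → ∀ j : Fin k, s.elt 0 (i * k + j) = some (S i j)

/-- Verification makes the output correct whatever the table contains. A failed attempt certifies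
that this table does not sort this sequence, which later shows that the search stops at a good
table. -/
theorem runs_attemptProg (hk : 0 < k) {m : ℕ} {S : Fin m → Fin k → α} {s : State α}
    (hs : Progress S s) (hlt : s.reg 2 < m) : Runs attemptProg s fun t s' => Progress S s' ∧
      ((s'.reg 2 = s.reg 2 + 1 ∧ s'.reg 4 = s.reg 4 ∧ s'.mem = s.mem ∧
          t ≤ 9 * s.reg 4 + 19 * k + 18) ∨
        (s'.reg 2 = s.reg 2 ∧
          tableRank k (s'.reg 4) (s'.mem 0) = tableRank k (s.reg 4) (s.mem 0) + 1 ∧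
          (¬ Lists (s.mem 0) (walk (WordLe (S ⟨s.reg 2, hlt⟩)) (s.mem 0) (s.reg 4) 0)
            (S ⟨s.reg 2, hlt⟩)) ∧
          t ≤ 9 * s.reg 4 + 13 * k + 9 * s.reg 5 + 29)) := by
  set i : Fin m := ⟨s.reg 2, hlt⟩
  rw [attemptProg, runs_seq]
  refine (runs_fetchProg s).mono ?_
  rintro t₁ s₁ ⟨ht₁, hr₁, hm₁, h0₁, h1₁⟩
  have hH : Holds (s₁.elt 1) (S i) := by
    intro j
    rw [h1₁, hs.reg_zero, hs.reg_three]
    split_ifs with hj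
    · exact hs.unsorted i le_rfl ⟨j, hj⟩
    · exact hs.empty j (not_lt.1 hj)
  rw [runs_seq]
  refine (runs_walkProg s₁).mono ?_
  rintro t₂ s₂ ⟨ht₂, hr₂, hm₂, he₂, h9₂⟩
  rw [runs_seq]
  refine (runs_verifyProg s₂).mono ?_
  rintro t₃ s₃ ⟨ht₃, hr₃, hm₃, he₃, h12⟩
  have hreg : ∀ x, x ≤ 5 ∨ x = 20 → s₃.reg x = s.reg x := fun x hx => by
    rw [hr₃ x (by omega) (by omega) (by omega) (by omega) (by omega),
      hr₂ x (by omega) (by omega) (by omega) (by omega), hr₁ x (by omega) (by omega)]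
  have g0 : s₂.reg 0 = k := by
    rw [hr₂ 0 (by omega) (by omega) (by omega) (by omega), hr₁ 0 (by omega) (by omega),
      hs.reg_zero]
  have g4 : s₁.reg 4 = s.reg 4 := hr₁ 4 (by omega) (by omega)
  have hmem : s₃.mem = s.mem := by rw [hm₃, hm₂, hm₁]
  have g9 : s₃.reg 9 = s₂.reg 9 := hr₃ 9 (by omega) (by omega) (by omega) (by omega) (by omega)
  rw [hm₁, g4, hH.eltLe] at h9₂
  rw [g0, he₂, hm₂, hm₁, hH.chain_iff_lists hk, h9₂] at h12
  have helt0 : ∀ j, s₃.elt 0 j = s.elt 0 j := fun j => by rw [he₃, he₂, h0₁]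
  have hH₃ : Holds (s₃.elt 1) (S i) := by rw [he₃, he₂]; exact hH
  have ht : t₁ + t₂ + t₃ ≤ 9 * s.reg 4 + 13 * k + 14 := by
    rw [g4] at ht₂
    rw [hs.reg_zero] at ht₁
    rw [g0] at ht₃
    omega
  have k0 : s₃.reg 0 = k := (hreg 0 (by omega)).trans hs.reg_zero
  have k1 : s₃.reg 1 = m := (hreg 1 (by omega)).trans hs.reg_one
  have k2 := hreg 2 (by omega)
  have k3 := hreg 3 (by omega)
  have k4 := hreg 4 (by omega)
  have k5 := hreg 5 (by omega)
  have k20 : s₃.reg 20 = 0 := (hreg 20 (by omega)).trans hs.reg_twenty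
  have hiff : (Test.natEq 12 20).Holds s₃ ↔
      Lists (s.mem 0) (walk (WordLe (S i)) (s.mem 0) (s.reg 4) 0) (S i) := by
    rw [holds_natEq, k20, h12]
  rw [runs_ite, hiff]
  refine ⟨fun hl => ?_, fun hl => ?_⟩
  · refine (runs_outputProg s₃).mono ?_
    rintro t₄ s' ⟨ht₄, hr, r2, r3, hm, he1, he0⟩
    have q4 : s'.reg 4 = s.reg 4 :=
      (hr 4 (by omega) (by omega) (by omega) (by omega) (by omega)).trans k4
    have q5 : s'.reg 5 = s.reg 5 :=
      (hr 5 (by omega) (by omega) (by omega) (by omega) (by omega)).trans k5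
    rw [k0, k3, hs.reg_three, hmem, g9, h9₂] at he0
    have hout : ∀ (i' : Fin m) (j : Fin k), i' ≠ i →
        s'.elt 0 (i' * k + j) = s.elt 0 (i' * k + j) := by
      intro i' j hne
      rw [he0, if_neg, helt0]
      rintro ⟨h1, h2⟩
      refine hne (Fin.ext (le_antisymm ?_ ?_))
      · refine Nat.lt_succ_iff.1 (lt_of_mul_lt_mul_right (a := k) ?_ (Nat.zero_le k))
        calc i'.1 * k ≤ i' * k + j := Nat.le_add_right _ _
          _ < s.reg 2 * k + k := h2
          _ = _ := (Nat.succ_mul _ _).symm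
      · refine Nat.lt_succ_iff.1 (lt_of_mul_lt_mul_right (a := k) ?_ (Nat.zero_le k))
        calc s.reg 2 * k ≤ i' * k + j := h1
          _ < i' * k + k := Nat.add_lt_add_left j.2 _
          _ = _ := (Nat.succ_mul _ _).symm
    refine ⟨⟨?_, ?_, ?_, ?_, ?_, ?_, ?_, ?_, ?_, ?_⟩,
      Or.inl ⟨by rw [r2, k2], q4, hm.trans hmem, by rw [k0] at ht₄; omega⟩⟩
    · exact (hr 0 (by omega) (by omega) (by omega) (by omega) (by omega)).trans k0
    · exact (hr 1 (by omega) (by omega) (by omega) (by omega) (by omega)).trans k1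
    · rw [r2, k2]
      exact hlt
    · rw [r3, r2, k3, k2, k0, hs.reg_three, Nat.succ_mul]
    · rw [q4, q5, hs.reg_five]
    · exact (hr 20 (by omega) (by omega) (by omega) (by omega) (by omega)).trans k20
    · rw [q5, hm, hmem]
      exact hs.table
    · intro j hj
      rw [he1, hH₃, dif_neg (not_lt.2 hj)]
    · intro i' hi'
      by_cases hii : i' = i
      · subst hii
        obtain ⟨σ, hσ, hM⟩ := hl.exists_perm
        refine ⟨σ, hσ, fun j => ?_⟩
        rw [he0, if_pos ⟨Nat.le_add_right _ _, Nat.add_lt_add_left j.2 _⟩,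
          show i.1 * k + j.1 - s.reg 2 * k = j.1 from Nat.add_sub_cancel_left _ _, hM, hH₃,
          dif_pos (σ j).2]
      · obtain ⟨σ, hσ, hM⟩ := hs.sorted i' (by
          have : i'.1 ≠ s.reg 2 := fun h => hii (Fin.ext h)
          omega)
        exact ⟨σ, hσ, fun j => by rw [hout i' j hii, hM]⟩
    · intro i' hi' j
      rw [hout i' j (fun h => by rw [h] at hi'; simp only [i] at hi'; omega),
        hs.unsorted i' (by omega)]
  · have p5 : s₃.reg 5 = tableSize k (s₃.reg 4) := by rw [k5, k4, hs.reg_five]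
    have pT : IsTable (s₃.reg 5) (s₃.mem 0) := by rw [k5, hmem]; exact hs.table
    refine (runs_advanceProg hk s₃ k20 p5 pT).mono ?_
    rintro t₄ s' ⟨ht₄, hr, he, h5, hT, hrank⟩
    have q2 : s'.reg 2 = s.reg 2 :=
      (hr 2 (by omega) (by omega) (by omega) (by omega) (by omega)).trans k2
    refine ⟨⟨?_, ?_, ?_, ?_, h5, ?_, hT, ?_, ?_, ?_⟩,
      Or.inr ⟨q2, by rw [hrank, k4, hmem], hl, by rw [k5] at ht₄; omega⟩⟩
    · exact (hr 0 (by omega) (by omega) (by omega) (by omega) (by omega)).trans k0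
    · exact (hr 1 (by omega) (by omega) (by omega) (by omega) (by omega)).trans k1
    · rw [q2]
      exact hs.reg_two
    · rw [hr 3 (by omega) (by omega) (by omega) (by omega) (by omega), k3, q2, hs.reg_three]
    · exact (hr 20 (by omega) (by omega) (by omega) (by omega) (by omega)).trans k20
    · intro j hj
      rw [he, hH₃, dif_neg (not_lt.2 hj)]
    · intro i' hi'
      rw [q2] at hi'
      simpa only [he, helt0] using hs.sorted i' hi'
    · intro i' hi' j
      rw [q2] at hi'
      rw [he, helt0, hs.unsorted i' hi']

/-- If the words of `V` are sorted by a decision tree of depth `D`, then the program sorts all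
sequences that are order isomorphic to words of `V` within time linear in `D` and `k` per sequence,
after an overhead that depends on `k` and `D` only. -/
theorem exists_exec_sortProg {β : Type*} [LinearOrder β] (hk : 0 < k) {m : ℕ}
    (S : Fin m → Fin k → α) {D : ℕ} {V : Set (Fin k → β)} (hV : Sortable D V)
    (hS : ∀ i, ∃ w ∈ V, ∀ a b, w a ≤ w b ↔ S i a ≤ S i b) :
    ∃ t s, Exec sortProg (initState S) t s ∧ IsSortedOutput S s ∧
      t ≤ m * (9 * D + 19 * k + 19) +
        tableCount k (D + 1) * (9 * D + 13 * k + 9 * tableSize k D + 30) + 2 := by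
  obtain ⟨M₀, hM₀, hlist⟩ := exists_table hk hV 0
  simp only [zero_add] at hM₀ hlist
  let M : ℕ → ℕ := fun x => if x < tableSize k D then M₀ x else 0
  have hT : IsTable (tableSize k D) M :=
    ⟨fun i hi => by simp only [M, if_pos hi]; exact hM₀ i, fun i hi => if_neg (not_lt.2 hi)⟩
  have hgood : ∀ M' : ℕ → ℕ, (∀ x < tableSize k D, M' x = M x) → ∀ i,
      Lists M' (walk (WordLe (S i)) M' D 0) (S i) := by
    intro M' hM' i
    obtain ⟨w, hw, hwS⟩ := hS i
    rw [← wordLe_congr hwS]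
    refine Lists.congr hwS (hlist M' (fun x _ hx => ?_) w hw)
    rw [hM' x hx]
    exact if_pos hx
  set R := tableRank k D M
  set A := 9 * D + 19 * k + 19
  set B := 9 * D + 13 * k + 9 * tableSize k D + 30
  have hrun : Runs sortProg (initState S) fun t s => IsSortedOutput S s ∧
      t ≤ m * A + R * B + 2 := by
    rw [sortProg, runs_seq, runs_copy]
    refine (runs_loop (fun s => Progress S s ∧ tableRank k (s.reg 4) (s.mem 0) ≤ R)
      -- Each success is paid for by a sequence still to be sorted, each failure by a rank still
      -- below that of the good table.
      (fun s => (m - s.reg 2) * A + (R - tableRank k (s.reg 4) (s.mem 0)) * B) ?_ ?_).mono ?_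
    · rintro s ⟨hs, hR⟩ hb
      have hb' : s.reg 2 < m := hs.reg_one ▸ hb
      have hd : s.reg 4 ≤ D := le_of_tableRank_le hT hR
      refine (runs_attemptProg hk hs hb').mono ?_
      rintro t s' ⟨hs', ⟨r2, r4, hm, ht⟩ | ⟨r2, hrank, hl, ht⟩⟩
      · rw [r4, hm, r2]
        refine ⟨⟨hs', hR⟩, ?_⟩
        have e : m - s.reg 2 = (m - (s.reg 2 + 1)) + 1 := by omega
        rw [e, Nat.succ_mul]
        omega
      -- At rank `R` the current table agrees with `M` on all cells that matter and would have
      -- succeeded, so a failure happens only at a smaller rank.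
      · have hne : tableRank k (s.reg 4) (s.mem 0) ≠ R := by
          intro heq
          obtain ⟨e4, hM⟩ := eq_of_tableRank_eq (hs.reg_five ▸ hs.table) hT heq
          exact hl (e4 ▸ hgood _ hM _)
        have hlt := lt_of_le_of_ne hR hne
        rw [hrank, r2]
        refine ⟨⟨hs', hlt⟩, ?_⟩
        have e : R - tableRank k (s.reg 4) (s.mem 0) =
          (R - (tableRank k (s.reg 4) (s.mem 0) + 1)) + 1 := by omega
        have h5 : s.reg 5 ≤ tableSize k D := hs.reg_five ▸ tableSize_mono k hd
        rw [e, Nat.succ_mul]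
        omega
    · refine ⟨⟨by simp [initState], by simp [initState], by simp [initState], by simp [initState],
        by simp [initState, tableSize], by simp [initState],
        ⟨by simp [initState, hk], by simp [initState]⟩, by simp [initState], by simp [initState],
        fun i _ j => ?_⟩, ?_⟩
      · have hlt : i.1 * k + j < m * k := by
          calc i.1 * k + j < i * k + k := Nat.add_lt_add_left j.2 _
            _ = (i + 1) * k := (Nat.succ_mul _ _).symm
            _ ≤ m * k := Nat.mul_le_mul_right k i.2
        simp only [State.setReg_elt, initState, true_and, hlt, dite_true]
        congr 2
        · apply Fin.ext
          simp [Fin.divNat, Nat.add_div_of_dvd_right, Nat.mul_div_cancel _ hk,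
            Nat.div_eq_of_lt j.2]
        · apply Fin.ext
          simp [Fin.modNat, Nat.mod_eq_of_lt j.2]
      · have : tableRank k 0 (fun _ => 0) = 0 := by
          simp [tableRank, tableCount, digitSum]
        simp [initState, this]
    · rintro t s ⟨⟨hs, -⟩, hb, ht⟩
      have hb' : ¬ s.reg 2 < m := hs.reg_one ▸ hb
      refine ⟨fun i => hs.sorted i (by omega), ?_⟩
      have h1 : (m - ((initState S).setReg 5 ((initState S).reg 0)).reg 2) * A ≤ m * A :=
        Nat.mul_le_mul_right _ (Nat.sub_le _ _)
      refine le_trans (Nat.add_le_add_left ht 1) ?_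
      have h2 := Nat.mul_le_mul_right B (Nat.sub_le R (tableRank k
        (((initState S).setReg 5 ((initState S).reg 0)).reg 4)
        (((initState S).setReg 5 ((initState S).reg 0)).mem 0)))
      omega
  obtain ⟨t, s, he, hsort, ht⟩ := hrun
  refine ⟨t, s, he, hsort, ht.trans ?_⟩
  have : R * B ≤ tableCount k (D + 1) * B := Nat.mul_le_mul_right B (tableRank_lt hT).le
  omega

end

/-! ### The running time -/

theorem tableSize_add_four (k d : ℕ) : tableSize k d + 4 = (k + 4) * 2 ^ d := by
  induction d with
  | zero => simp [tableSize]
  | succ d ih =>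
    rw [tableSize, pow_succ]
    linarith

theorem tableCount_succ_le {k : ℕ} (hk : 0 < k) (d : ℕ) :
    tableCount k (d + 1) ≤ (d + 1) * tableSize k d ^ tableSize k d := by
  unfold tableCount
  refine (Finset.sum_le_card_nsmul _ _ (tableSize k d ^ tableSize k d) fun e he => ?_).trans
    (by simp)
  have h := tableSize_mono k (Nat.lt_succ_iff.1 (Finset.mem_range.1 he))
  exact (Nat.pow_le_pow_left h _).trans
    (Nat.pow_le_pow_right (hk.trans_le (le_tableSize k d)) h)

/-- With `N` the table size, the count of tables is at most `(D + 1) * N ^ N` and the cost factor at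
most `61 * N`. Since `N ≤ 2 ^ L`, the total is at most `2 ^ (6 + L * (N + 2))`, and this exponent is
singly exponential in `L`. -/
theorem overhead_le {k : ℕ} (hk : 0 < k) (D : ℕ) :
    tableCount k (D + 1) * (9 * D + 13 * k + 9 * tableSize k D + 30) + 2 ≤
      2 ^ 2 ^ (2 * (D + k + 2) + 1) := by
  set N := tableSize k D with hN
  set L := D + k + 2 with hL
  have h4 : N + 4 = (k + 4) * 2 ^ D := tableSize_add_four k D
  have hD : D + 1 ≤ 2 ^ D := Nat.lt_two_pow_self
  have hDN : D + 1 ≤ N := by nlinarith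
  have hkN : k ≤ N := le_tableSize k D
  have hk4 : k + 4 ≤ 2 ^ (k + 2) := by
    have : k + 1 ≤ 2 ^ k := Nat.lt_two_pow_self
    rw [pow_add]
    omega
  have hNL : N ≤ 2 ^ L := by
    calc N ≤ N + 4 := by omega
      _ ≤ 2 ^ (k + 2) * 2 ^ D := by rw [h4]; gcongr
      _ = 2 ^ L := by rw [← pow_add]; congr 1; omega
  have hL2 : L + 1 ≤ 2 ^ L := Nat.lt_two_pow_self
  have hL8 : 8 ≤ 2 ^ L := by
    calc 8 = 2 ^ 3 := by norm_num
      _ ≤ 2 ^ L := Nat.pow_le_pow_right (by norm_num) (by omega)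
  calc _ ≤ (D + 1) * N ^ N * (61 * N) + 2 := by
        gcongr
        · exact tableCount_succ_le hk D
        · omega
    _ ≤ N * N ^ N * (61 * N) + 2 := by gcongr
    _ ≤ 64 * N ^ (N + 2) := by
        have : 1 ≤ N ^ (N + 2) := Nat.one_le_pow _ _ (by omega)
        have e : N * N ^ N * (61 * N) = 61 * N ^ (N + 2) := by ring
        omega
    _ ≤ 2 ^ 6 * (2 ^ L) ^ (N + 2) := by gcongr; norm_num
    _ = 2 ^ (6 + L * (N + 2)) := by rw [← pow_mul, ← pow_add]
    _ ≤ _ := by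
        refine Nat.pow_le_pow_right (by norm_num) ?_
        have e : 2 ^ (2 * L + 1) = 2 * (2 ^ L * 2 ^ L) := by ring
        rw [e]
        nlinarith

theorem log_pow_self_le (k : ℕ) : Nat.log 2 (k ^ k) ≤ k * (Nat.log 2 k + 1) := by
  have h : k ≤ 2 ^ (Nat.log 2 k + 1) := (Nat.lt_pow_succ_log_self (by norm_num) k).le
  calc Nat.log 2 (k ^ k) ≤ Nat.log 2 ((2 ^ (Nat.log 2 k + 1)) ^ k) :=
        Nat.log_mono_right (Nat.pow_le_pow_left h k)
    _ = k * (Nat.log 2 k + 1) := by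
        rw [← pow_mul, Nat.log_pow (by norm_num), mul_comm]

/-- The exponent of the overhead. -/
def overheadExponent (k : ℕ) : ℕ :=
  15 * k + 4 * (k * Nat.log 2 k)

theorem isBigO_overheadExponent :
    (fun k => (overheadExponent k : ℝ)) =O[atTop] fun k : ℕ => (k : ℝ) * Real.logb 2 k := by
  refine IsBigO.of_bound 19 ?_
  filter_upwards [eventually_ge_atTop 2] with k hk
  have hk' : (2 : ℝ) ≤ k := by exact_mod_cast hk
  have h1 : 1 ≤ Real.logb 2 k := by
    rw [Real.le_logb_iff_rpow_le (by norm_num) (by linarith)]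
    simpa using hk'
  have h2 : (Nat.log 2 k : ℝ) ≤ Real.logb 2 k := by
    exact_mod_cast Real.natLog_le_logb k 2
  rw [Real.norm_of_nonneg (by positivity), Real.norm_of_nonneg (by positivity)]
  simp only [overheadExponent]
  push_cast
  nlinarith

/-- A nonempty sequence contains every pattern of length at most one. Thus an avoided pattern has
limit at least `1` and the logarithm in the bound is nonnegative. -/
theorem length_ge_two_of_avoids {α : Type*} [LinearOrder α] {k l : ℕ} (hk : 0 < k) {s : Fin k → α}
    {π : Equiv.Perm (Fin l)} (h : SeqAvoids s π) : 2 ≤ l := by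
  by_contra! hl
  have : Subsingleton (Fin l) := Fin.subsingleton_iff_le_one.2 (by omega)
  refine h ⟨OrderEmbedding.ofStrictMono (fun _ => ⟨0, hk⟩) (Subsingleton.strictMono _),
    fun a b => ?_⟩
  simp [Subsingleton.elim a b]

theorem log_card_avoidingWords_le {l : ℕ} (hl : 2 ≤ l) (π : Equiv.Perm (Fin l)) (k : ℕ) :
    (Nat.log 2 (avoidingWords π k).card : ℝ) ≤
      12 * k * (Real.logb 2 (furediHajnalLimit π) + 1) := by
  set c := furediHajnalLimit π
  have hc : 1 ≤ c := one_le_furediHajnalLimit hl π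
  have hlog : 0 ≤ Real.logb 2 c := Real.logb_nonneg (by norm_num) hc
  rcases Nat.eq_zero_or_pos (avoidingWords π k).card with h0 | hpos
  · rw [h0]
    simp
    positivity
  -- The count needs an integral bound; rounding up at most doubles `c` because `1 ≤ c`, which adds
  -- at most `1` to the logarithm.
  set A := ⌈c⌉₊
  have hA : 1 ≤ A := Nat.one_le_ceil_iff.2 (by linarith)
  have hAr : (1 : ℝ) ≤ A := by exact_mod_cast hA
  have hex : ∀ n, ex π n ≤ A * n := fun n => by
    have h1 := ex_le_furediHajnalLimit_mul π n
    have h2 : c * n ≤ A * n := mul_le_mul_of_nonneg_right (Nat.le_ceil c) (by positivity)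
    exact_mod_cast h1.trans h2
  have hA2 : (A : ℝ) ≤ 2 * c := by
    have := Nat.ceil_lt_add_one (show 0 ≤ c by linarith)
    linarith
  have hlogA : Real.logb 2 A ≤ 1 + Real.logb 2 c := by
    calc Real.logb 2 A ≤ Real.logb 2 (2 * c) :=
          Real.logb_le_logb_of_le (by norm_num) (by linarith) hA2
      _ = 1 + Real.logb 2 c := by
          rw [Real.logb_mul (by norm_num) (by linarith)]
          simp
  calc (Nat.log 2 (avoidingWords π k).card : ℝ) ≤ Real.logb 2 (avoidingWords π k).card := by
        exact_mod_cast Real.natLog_le_logb _ 2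
    _ ≤ Real.logb 2 (2 ^ (10 * k) * A ^ (2 * k)) := by
        refine Real.logb_le_logb_of_le (by norm_num) (by exact_mod_cast hpos) ?_
        exact_mod_cast card_avoidingWords_le hA hex k
    _ = 10 * k + 2 * k * Real.logb 2 A := by
        rw [Real.logb_mul (by positivity) (by positivity), Real.logb_pow, Real.logb_pow]
        simp
    _ ≤ 10 * k + 2 * k * (1 + Real.logb 2 c) := by gcongr
    _ ≤ _ := by nlinarith [mul_nonneg (Nat.cast_nonneg (α := ℝ) k) hlog]

theorem sortsWithin_sortProg {l : ℕ} {π : Equiv.Perm (Fin l)} {α : Type*} [LinearOrder α] {m k : ℕ}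
    (hk : 0 < k) {S : Fin m → Fin k → α} (hS : ∀ i, SeqAvoids (S i) π) :
    SortsWithin sortProg S
      (272 * (Real.logb 2 (furediHajnalLimit π) + 1) * ((m * k : ℕ) : ℝ)
        + (2 : ℝ) ^ ((2 : ℝ) ^ (overheadExponent k : ℝ))) := by
  set D := 2 * (k + Nat.log 2 (avoidingWords π k).card) with hDdef
  obtain ⟨t, s, he, hsort, ht⟩ := exists_exec_sortProg hk S (sortable_finset hk (avoidingWords π k))
    fun i => ⟨rankWord (S i), by simpa using mem_avoidingWords.2 (hS i).rankWord,
      rankWord_le_iff (S i)⟩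
  refine ⟨t, s, he, ?_, hsort⟩
  have hover : tableCount k (D + 1) * (9 * D + 13 * k + 9 * tableSize k D + 30) + 2 ≤
      2 ^ 2 ^ overheadExponent k := by
    refine (overhead_le hk D).trans (Nat.pow_le_pow_right (by norm_num)
      (Nat.pow_le_pow_right (by norm_num) ?_))
    -- The overhead must not depend on `π`, so all `k ^ k` words are counted here. This gives `D ≤ 4
    -- * k + 2 * (k * Nat.log 2 k)`, and `1 ≤ k` absorbs the constant `5` of `2 * (D + k + 2) + 1`
    -- into `15 * k`.
    have h1 := (Nat.log_mono_right (b := 2) (card_avoidingWords_le_pow_self π k)).trans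
      (log_pow_self_le k)
    rw [Nat.mul_succ] at h1
    rw [hDdef, overheadExponent]
    omega
  have hover' : ((2 ^ 2 ^ overheadExponent k : ℕ) : ℝ) =
      (2 : ℝ) ^ ((2 : ℝ) ^ (overheadExponent k : ℝ)) := by
    rw [Real.rpow_natCast, ← Nat.cast_ofNat (R := ℝ) (n := 2), ← Nat.cast_pow, Real.rpow_natCast,
      ← Nat.cast_pow]
  have hmain : ((m * (9 * D + 19 * k + 19) : ℕ) : ℝ) ≤
      272 * (Real.logb 2 (furediHajnalLimit π) + 1) * ((m * k : ℕ) : ℝ) := by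
    -- Without sequences nothing forces `2 ≤ l`, but both sides are zero.
    rcases Nat.eq_zero_or_pos m with rfl | hm
    · simp
    have hl : 2 ≤ l := length_ge_two_of_avoids hk (hS ⟨0, hm⟩)
    have hlog : 0 ≤ Real.logb 2 (furediHajnalLimit π) :=
      Real.logb_nonneg (by norm_num) (one_le_furediHajnalLimit hl π)
    have hcard := log_card_avoidingWords_le hl π k
    have hk1 : (1 : ℝ) ≤ k := by exact_mod_cast hk
    set r := Real.logb 2 (furediHajnalLimit π)
    have hkr : 0 ≤ k * r := mul_nonneg (by linarith) hlog
    -- Here `D ≤ 2 * k + 24 * k * (r + 1)`, so the coefficient of `k` is at most `9 * 26 + 19 + 19 =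
    -- 272`.
    have hone : ((9 * D + 19 * k + 19 : ℕ) : ℝ) ≤ 272 * (r + 1) * k := by
      rw [hDdef]
      push_cast
      nlinarith
    push_cast at hone ⊢
    calc (m : ℝ) * (9 * D + 19 * k + 19) ≤ m * (272 * (r + 1) * k) := by gcongr
      _ = _ := by ring
  rw [← hover']
  calc (t : ℝ) ≤ ((m * (9 * D + 19 * k + 19) + (tableCount k (D + 1) *
        (9 * D + 13 * k + 9 * tableSize k D + 30) + 2) : ℕ) : ℝ) := by exact_mod_cast ht
    _ = ((m * (9 * D + 19 * k + 19) : ℕ) : ℝ) + ((tableCount k (D + 1) *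
        (9 * D + 13 * k + 9 * tableSize k D + 30) + 2 : ℕ) : ℝ) := Nat.cast_add _ _
    _ ≤ _ := add_le_add hmain (Nat.cast_le.2 hover)

end PatternSort

theorem mainTheorem5 :
    (∀ (l : ℕ) (π : Equiv.Perm (Fin l)),
      Tendsto (fun n : ℕ => (PatternSort.ex π n : ℝ) / n) atTop
        (𝓝 (PatternSort.furediHajnalLimit π))) ∧
    ∃ (P : PatternSort.Prog) (C : ℝ) (f : ℕ → ℝ),
      f =O[atTop] (fun k : ℕ => (k : ℝ) * Real.logb 2 k) ∧
      ∀ (l : ℕ) (π : Equiv.Perm (Fin l)) (α : Type*) [LinearOrder α] (m k : ℕ), 1 ≤ k →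
        ∀ S : Fin m → Fin k → α, (∀ i, PatternSort.SeqAvoids (S i) π) →
          PatternSort.SortsWithin P S
            (C * (Real.logb 2 (PatternSort.furediHajnalLimit π) + 1) * ((m * k : ℕ) : ℝ)
              + (2 : ℝ) ^ ((2 : ℝ) ^ f k)) :=
  ⟨fun _ π => PatternSort.tendsto_furediHajnalLimit π, PatternSort.sortProg, 272,
    fun k => PatternSort.overheadExponent k, PatternSort.isBigO_overheadExponent,
    fun _ _ _ _ _ _ hk _ hS => PatternSort.sortsWithin_sortProg hk hS⟩
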